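/- Fix a finite alphabet $\Sigma$. A \emph{pomset} over $\Sigma$ is an isomorphism class of countable $\Sigma$-labelled partially ordered sets; $1$ is the empty pomset, $\mathtt{a}\in\Sigma$ is identified with the one-event pomset labelled $\mathtt{a}$, $U\cdot V$ is sequential composition (all events of $U$ before all events of $V$) and $U\parallel V$ is parallel composition (disjoint union). The series-parallel pomsets $\mathsf{SP}(\Sigma)$ form the smallest set that contains $1$ and all $\mathtt{a}\in\Sigma$ and is closed under $\cdot$ and $\parallel$. Write $\mathbb{M}(Q)$ for the set of finite multisets over $Q$. A \emph{pomset automaton} (PA) is a tuple $A=\langle Q,F,\delta,\gamma\rangle$ with a set $Q$ of states, accepting states $F\subseteq Q$, $\delta: Q\times\Sigma\to 2^Q$ and $\gamma: Q\times\mathbb{M}(Q)\to 2^Q$, such that for each $q\in Q$ only finitely many $\phi\in\mathbb{M}(Q)$ satisfy $\gamma(q,\phi)\neq\emptyset$. It is \emph{finite} if $Q$ is finite. The run relation ${\to_A}\subseteq Q\times\mathsf{SP}(\Sigma)\times Q$ is the smallest relation such that (1) $q\xrightarrow{1}q$; (2) $q\xrightarrow{\mathtt a}q'$ if $q'\in\delta(q,\mathtt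 a)$; (3) $q\xrightarrow{U\cdot V}q'$ if $q\xrightarrow{U}q''$ and $q''\xrightarrow{V}q'$; (4) $q\xrightarrow{U_1\parallel\dots\parallel U_n}q'$ if $n\ge 0$, $q'\in\gamma(q,\{\!\{q_1,\dots,q_n\}\!\})$ and $q_i\xrightarrow{U_i}q_i'\in F$ for all $1\le i\le n$. The language of $q$ is $L_A(q)=\{U\in\mathsf{SP}(\Sigma) : q\xrightarrow{U}q' \text{ for some } q'\in F\}$. The support relation $\preceq_A$ is the smallest preorder on $Q$ such that $q'\preceq_A q$ whenever $q'\in\delta(q,\mathtt a)$ for some $\mathtt a$, or $q'\in\gamma(q,\phi)$ for some $\phi$, or $q'\in\phi$ for some $\phi$ with $\gamma(q,\phi)\ne\emptyset$. Write $q'\prec_A q$ if $q'\preceq_A q$ and $q\not\preceq_A q'$. The PA $A$ is \emph{fork-acyclic} if $r\prec_A q$ whenever $r\in\phi$ and $\gamma(q,\phi)\neq\emptyset$. It is \emph{well-structured} if, whenever $\gamma(q,\phi)\ne\emptyset$, we have $|\phi|\ge 2$ and every $q'\in\phi$ satisfies $q'\notin F$ and $\gamma(q',\phi')\cap F=\emptyset$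 for all $\phi'\in\mathbb{M}(Q)$. A PA $A'$ with state set $Q'$ \emph{implements} $A$ if $Q\subseteq Q'$, $L_A(q)=L_{A'}(q)$ for all $q\in Q$, and $A'$ is fork-acyclic (resp. finite) if $A$ is. \textbf{Theorem.} For every finite and fork-acyclic PA $A$ there is a finite and fork-acyclic PA $A'$ that is well-structured and implements $A$. Moreover, $A'$ can be constructed effectively: for every alphabet $\Sigma=\{0,\dots,k-1\}$ there is a computable function on finite PAs whose states are $\{0,\dots,n-1\}$ for some $n\in\mathbb{N}$, each presented by $n$ and the finite lists of its accepting states and of its sequential and parallel transitions, that maps every fork-acyclic such $A$ to a finite and fork-acyclic PA $A'$ that is well-structured and implements $A$. -/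

import Mathlib

universe u v w

/-! ### Pomsets -/

/-- A labelled poset over the alphabet `α`.  Carriers are countable, so that, up to isomorphism,
they are exactly the subsets of `ℕ`. -/
structure LabelledPoset (α : Type u) where
  carrier : Type
  order : PartialOrder carrier
  countable : Countable carrier
  label : carrier → α

namespace LabelledPoset

variable {α : Type u}

instance (x : LabelledPoset α) : PartialOrder x.carrier := x.order

instance (x : LabelledPoset α) : Countable x.carrier := x.countable

/-- Label-preserving order isomorphism. -/
def Iso (x y : LabelledPoset α) : Prop :=
  ∃ e : x.carrier ≃o y.carrier, ∀ s, y.label (e s) = x.label s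

theorem Iso.refl (x : LabelledPoset α) : Iso x x := ⟨OrderIso.refl _, fun _ => rfl⟩

theorem Iso.symm {x y : LabelledPoset α} : Iso x y → Iso y x := by
  rintro ⟨e, he⟩
  exact ⟨e.symm, fun s => by rw [← he, e.apply_symm_apply]⟩

theorem Iso.trans {x y z : LabelledPoset α} : Iso x y → Iso y z → Iso x z := by
  rintro ⟨e, he⟩ ⟨f, hf⟩
  exact ⟨e.trans f, fun s => by rw [OrderIso.trans_apply, hf, he]⟩

instance setoid (α : Type u) : Setoid (LabelledPoset α) where
  r := Iso
  iseqv := ⟨Iso.refl, Iso.symm, Iso.trans⟩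

/-- The labelled poset without events. -/
def empty (α : Type u) : LabelledPoset α where
  carrier := Empty
  order := inferInstance
  countable := inferInstance
  label := Empty.elim

/-- The labelled poset with a single event, labelled by `a`. -/
def single (a : α) : LabelledPoset α where
  carrier := Unit
  order := inferInstance
  countable := inferInstance
  label := fun _ => a

/-- Sequential composition: every event of `x` comes before every event of `y`. -/
def seq (x y : LabelledPoset α) : LabelledPoset α where
  carrier := x.carrier ⊕ₗ y.carrier
  order := inferInstance
  countable := inferInstanceAs (Countable (x.carrier ⊕ y.carrier))
  label := fun s => Sum.elim x.label y.label (ofLex s)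

/-- Parallel composition: events of `x` and of `y` are incomparable. -/
def par (x y : LabelledPoset α) : LabelledPoset α where
  carrier := x.carrier ⊕ y.carrier
  order := inferInstance
  countable := inferInstance
  label := Sum.elim x.label y.label

theorem seq_congr {x x' y y' : LabelledPoset α} (hx : Iso x x') (hy : Iso y y') :
    Iso (seq x y) (seq x' y') := by
  obtain ⟨e, he⟩ := hx
  obtain ⟨f, hf⟩ := hy
  refine ⟨OrderIso.sumLexCongr e f, fun s => ?_⟩
  cases s with
  | inl s => exact he s
  | inr s => exact hf s

theorem par_congr {x x' y y' : LabelledPoset α} (hx : Iso x x') (hy : Iso y y') :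
    Iso (par x y) (par x' y') := by
  obtain ⟨e, he⟩ := hx
  obtain ⟨f, hf⟩ := hy
  refine ⟨OrderIso.sumCongr e f, fun s => ?_⟩
  cases s with
  | inl s => exact he s
  | inr s => exact hf s

end LabelledPoset

/-- A pomset is an isomorphism class of labelled posets. -/
def Pomset (α : Type u) : Type (max 1 u) := Quotient (LabelledPoset.setoid α)

namespace Pomset

variable {α : Type u}

/-- The empty pomset. -/
def empty : Pomset α := Quotient.mk _ (LabelledPoset.empty α)

/-- The primitive pomset with one event, labelled by `a`. -/
def prim (a : α) : Pomset α := Quotient.mk _ (LabelledPoset.single a)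

/-- Sequential composition `U · V`. -/
def seq : Pomset α → Pomset α → Pomset α :=
  Quotient.map₂ LabelledPoset.seq fun _ _ hx _ _ hy => LabelledPoset.seq_congr hx hy

/-- Parallel composition `U ∥ V`. -/
def par : Pomset α → Pomset α → Pomset α :=
  Quotient.map₂ LabelledPoset.par fun _ _ hx _ _ hy => LabelledPoset.par_congr hx hy

/-- The parallel composition of a finite family; it is empty for the empty family. -/
def parFamily {n : ℕ} (U : Fin n → Pomset α) : Pomset α :=
  (List.ofFn U).foldr par empty

/-- Series-parallel pomsets. -/
inductive SeriesParallel : Pomset α → Prop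
  | empty : SeriesParallel Pomset.empty
  | prim (a : α) : SeriesParallel (Pomset.prim a)
  | seq {U V : Pomset α} : SeriesParallel U → SeriesParallel V → SeriesParallel (Pomset.seq U V)
  | par {U V : Pomset α} : SeriesParallel U → SeriesParallel V → SeriesParallel (Pomset.par U V)

end Pomset

/-! ### Pomset automata -/

/-- A pomset automaton over the alphabet `α` with set of states `Q`. -/
structure PomsetAutomaton (α : Type u) (Q : Type v) where
  /-- the accepting states -/
  accept : Set Q
  /-- the sequential transition function -/
  δ : Q → α → Set Q
  /-- the parallel transition function -/
  γ : Q → Multiset Q → Set Q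
  finite_forks : ∀ q, {φ | (γ q φ).Nonempty}.Finite

namespace PomsetAutomaton

variable {α : Type u} {Q : Type v} {Q' : Type w}

/-- The run relation: `A.Run q U q'` says that `A` can read `U` while moving from `q` to `q'`. -/
inductive Run (A : PomsetAutomaton α Q) : Q → Pomset α → Q → Prop
  | trivial (q : Q) : Run A q Pomset.empty q
  | letter {q q' : Q} {a : α} : q' ∈ A.δ q a → Run A q (Pomset.prim a) q'
  | comp {q q' q'' : Q} {U V : Pomset α} :
      Run A q U q'' → Run A q'' V q' → Run A q (Pomset.seq U V) q'
  | fork {q q' : Q} {n : ℕ} (r r' : Fin n → Q) (U : Fin n → Pomset α) :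
      (∀ i, Run A (r i) (U i) (r' i)) → (∀ i, r' i ∈ A.accept) →
      q' ∈ A.γ q (List.ofFn r : Multiset Q) → Run A q (Pomset.parFamily U) q'

/-- The language of the state `q`. -/
def language (A : PomsetAutomaton α Q) (q : Q) : Set (Pomset α) :=
  {U | U.SeriesParallel ∧ ∃ q' ∈ A.accept, A.Run q U q'}

/-- The generating pairs of the support relation; `A.SupportStep q' q` is read `q' ⪯ q`. -/
inductive SupportStep (A : PomsetAutomaton α Q) : Q → Q → Prop
  | seq {q q' : Q} {a : α} : q' ∈ A.δ q a → SupportStep A q' q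
  | join {q q' : Q} {φ : Multiset Q} : q' ∈ A.γ q φ → SupportStep A q' q
  | target {q r : Q} {φ : Multiset Q} : r ∈ φ → (A.γ q φ).Nonempty → SupportStep A r q

/-- The support relation `q' ⪯ q`, the smallest preorder that contains the generating pairs. -/
def Supports (A : PomsetAutomaton α Q) (q' q : Q) : Prop :=
  Relation.ReflTransGen A.SupportStep q' q

/-- The strict support relation `q' ≺ q`. -/
def StrictlySupports (A : PomsetAutomaton α Q) (q' q : Q) : Prop :=
  A.Supports q' q ∧ ¬ A.Supports q q'

/-- Every fork target of a state strictly supports that state. -/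
def ForkAcyclic (A : PomsetAutomaton α Q) : Prop :=
  ∀ (q r : Q) (φ : Multiset Q), r ∈ φ → (A.γ q φ).Nonempty → A.StrictlySupports r q

/-- Well-structured pomset automata.  The bound on the size of `φ` is imposed on every fork,
including the fork into the empty multiset, which has no targets. -/
def WellStructured (A : PomsetAutomaton α Q) : Prop :=
  ∀ (q : Q) (φ : Multiset Q), (A.γ q φ).Nonempty →
    2 ≤ φ.card ∧ ∀ q' ∈ φ, q' ∉ A.accept ∧ ∀ φ' : Multiset Q, A.γ q' φ' ∩ A.accept = ∅

/-- `A'` implements `A`, where `e` is the inclusion of the states of `A` in those of `A'`. -/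
def Implements (A' : PomsetAutomaton α Q') (A : PomsetAutomaton α Q) (e : Q ↪ Q') : Prop :=
  (∀ q, A.language q = A'.language (e q)) ∧
    (A.ForkAcyclic → A'.ForkAcyclic) ∧ (Finite Q → Finite Q')

end PomsetAutomaton

/-! ### Finite pomset automata as finite data -/

/-- A finite pomset automaton over the alphabet `Fin k`, written down as finite data: the number
of states, the list of accepting states, the list of the triples `(q, a, q')` with `q' ∈ δ(q, a)`
and the list of the triples `(q, [r₁, …, rₙ], q')` with `q' ∈ γ(q, {{r₁, …, rₙ}})`.
Entries that mention a number which is not a state are ignored. -/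
abbrev FinitePA (k : ℕ) : Type :=
  ℕ × List ℕ × List (ℕ × Fin k × ℕ) × List (ℕ × List ℕ × ℕ)

namespace FinitePA

variable {k : ℕ}

/-- The number of states. -/
abbrev size (c : FinitePA k) : ℕ := c.1

/-- The pomset automaton with states `0, …, c.size - 1` that is described by `c`. -/
def toPA (c : FinitePA k) : PomsetAutomaton (Fin k) (Fin c.size) where
  accept := {q | (q : ℕ) ∈ c.2.1}
  δ q a := {q' | ((q : ℕ), a, (q' : ℕ)) ∈ c.2.2.1}
  γ q φ := {q' | ∃ l : List ℕ, ((q : ℕ), l, (q' : ℕ)) ∈ c.2.2.2 ∧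
    φ.map (fun r : Fin c.size => (r : ℕ)) = (l : Multiset ℕ)}
  finite_forks q := by
    refine Set.Finite.of_finite_image (f := Multiset.map (fun r : Fin c.size => (r : ℕ))) ?_
      (Multiset.map_injective Fin.val_injective).injOn
    refine ((c.2.2.2.map fun t => (t.2.1 : Multiset ℕ)).finite_toSet).subset ?_
    rintro _ ⟨φ, ⟨q', l, hl, h⟩, rfl⟩
    exact List.mem_map.2 ⟨_, hl, h.symm⟩

end FinitePA

namespace Pomset

variable {α : Type u}

theorem mk_eq_mk {x y : LabelledPoset α} (e : x.carrier ≃o y.carrier)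
    (he : ∀ s, y.label (e s) = x.label s) :
    (Quotient.mk (LabelledPoset.setoid α) x : Pomset α) = Quotient.mk _ y :=
  Quotient.sound ⟨e, he⟩

theorem seq_assoc (U V W : Pomset α) : seq (seq U V) W = seq U (seq V W) := by
  induction U using Quotient.inductionOn with | _ x
  induction V using Quotient.inductionOn with | _ y
  induction W using Quotient.inductionOn with | _ z
  refine mk_eq_mk (OrderIso.sumLexAssoc x.carrier y.carrier z.carrier) ?_
  rintro ((s | s) | s) <;> rfl

theorem par_assoc (U V W : Pomset α) : par (par U V) W = par U (par V W) := by
  induction U using Quotient.inductionOn with | _ x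
  induction V using Quotient.inductionOn with | _ y
  induction W using Quotient.inductionOn with | _ z
  refine mk_eq_mk (OrderIso.sumAssoc x.carrier y.carrier z.carrier) ?_
  rintro ((s | s) | s) <;> rfl

theorem par_comm (U V : Pomset α) : par U V = par V U := by
  induction U using Quotient.inductionOn with | _ x
  induction V using Quotient.inductionOn with | _ y
  refine mk_eq_mk (OrderIso.sumComm x.carrier y.carrier) ?_
  rintro (s | s) <;> rfl

/-- The order isomorphism that removes an empty summand. -/
def sumEmptyIso (β : Type*) [PartialOrder β] : β ⊕ Empty ≃o β where
  toEquiv := Equiv.sumEmpty β Empty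
  map_rel_iff' := by
    rintro (a | a) (b | b)
    · simp
    all_goals exact Empty.elim ‹_›

@[simp]
theorem par_empty (U : Pomset α) : par U empty = U := by
  induction U using Quotient.inductionOn with | _ x
  refine mk_eq_mk (sumEmptyIso x.carrier) ?_
  rintro (s | s)
  · rfl
  · exact Empty.elim s

@[simp]
theorem empty_par (U : Pomset α) : par empty U = U := by
  rw [par_comm, par_empty]

/-- The order isomorphism that removes an empty last summand of a lexicographic sum. -/
def sumLexEmptyIso (β : Type*) [PartialOrder β] : β ⊕ₗ Empty ≃o β where
  toEquiv := ofLex.trans (Equiv.sumEmpty β Empty)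
  map_rel_iff' := by
    intro a b
    rcases a with a | a <;> rcases b with b | b
    · exact Sum.Lex.inl_le_inl_iff.symm
    all_goals exact Empty.elim ‹_›

/-- The order isomorphism that removes an empty first summand of a lexicographic sum. -/
def emptySumLexIso (β : Type*) [PartialOrder β] : Empty ⊕ₗ β ≃o β where
  toEquiv := ofLex.trans (Equiv.emptySum Empty β)
  map_rel_iff' := by
    intro a b
    rcases a with a | a <;> rcases b with b | b
    on_goal 4 => exact Sum.Lex.inr_le_inr_iff.symm
    all_goals exact Empty.elim ‹_›

@[simp]
theorem seq_empty (U : Pomset α) : seq U empty = U := by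
  induction U using Quotient.inductionOn with | _ x
  refine mk_eq_mk (sumLexEmptyIso x.carrier) ?_
  rintro (s | s)
  · rfl
  · exact Empty.elim s

@[simp]
theorem empty_seq (U : Pomset α) : seq empty U = U := by
  induction U using Quotient.inductionOn with | _ x
  refine mk_eq_mk (emptySumLexIso x.carrier) ?_
  rintro (s | s)
  · exact Empty.elim s
  · rfl

/-- The parallel composition of a list of pomsets. -/
def parList (L : List (Pomset α)) : Pomset α := L.foldr par empty

@[simp]
theorem parList_nil : parList ([] : List (Pomset α)) = empty := rfl

@[simp]
theorem parList_cons (U : Pomset α) (L : List (Pomset α)) :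
    parList (U :: L) = par U (parList L) := rfl

theorem parList_append (L L' : List (Pomset α)) :
    parList (L ++ L') = par (parList L) (parList L') := by
  induction L with
  | nil => simp
  | cons U L ih => simp [ih, par_assoc]

theorem parList_perm {L L' : List (Pomset α)} (h : L.Perm L') : parList L = parList L' := by
  have : LeftCommutative (par : Pomset α → Pomset α → Pomset α) :=
    ⟨fun U V W => by rw [← par_assoc, par_comm U V, par_assoc]⟩
  exact h.foldr_eq _

theorem SeriesParallel.parList {L : List (Pomset α)} (h : ∀ U ∈ L, U.SeriesParallel) :
    (parList L).SeriesParallel := by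
  induction L with
  | nil => exact .empty
  | cons U L ih =>
    exact .par (h U (by simp)) (ih fun V hV => h V (by simp [hV]))

end Pomset

theorem List.forall₂_ofFn {β : Type u} {γ : Type v} {R : β → γ → Prop} {n : ℕ} {f : Fin n → β}
    {g : Fin n → γ} (h : ∀ i, R (f i) (g i)) : List.Forall₂ R (List.ofFn f) (List.ofFn g) := by
  rw [List.forall₂_iff_get]
  exact ⟨by simp, fun i h₁ h₂ => by simpa using h ⟨i, by simpa using h₁⟩⟩

namespace PomsetAutomaton

variable {α : Type u} {Q : Type v} {Q' : Type w}

/-- The pomsets that `A` can read from `q` on the way to an accepting state. -/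
def Accepts (A : PomsetAutomaton α Q) (q : Q) (U : Pomset α) : Prop :=
  ∃ q' ∈ A.accept, A.Run q U q'

theorem Run.forkList {A : PomsetAutomaton α Q} {q q' : Q} {l : List Q} {L : List (Pomset α)}
    (h : List.Forall₂ A.Accepts l L) (hq : q' ∈ A.γ q (l : Multiset Q)) :
    A.Run q (Pomset.parList L) q' := by
  obtain ⟨hlen, h⟩ := List.forall₂_iff_get.1 h
  choose r' hr' hrun using fun i : Fin l.length => h i i.2 (hlen ▸ i.2)
  have hL : L = List.ofFn fun i : Fin l.length => L.get ⟨i, hlen ▸ i.2⟩ := by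
    apply List.ext_get <;> simp [hlen]
  have hl : l = List.ofFn fun i : Fin l.length => l.get i := by simp
  rw [hL]
  exact Run.fork (fun i => l.get i) r' _ hrun hr' (hl ▸ hq)

/-- Induction on runs in which forks are presented by lists. -/
theorem Run.listInduction {A : PomsetAutomaton α Q} {P : Q → Pomset α → Q → Prop}
    (trivial : ∀ q, P q Pomset.empty q)
    (letter : ∀ {q q' a}, q' ∈ A.δ q a → P q (Pomset.prim a) q')
    (comp : ∀ {q q' q'' U V}, P q U q'' → P q'' V q' → A.Run q U q'' → A.Run q'' V q' →
      P q (Pomset.seq U V) q')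
    (fork : ∀ {q q'} (l : List Q) (L : List (Pomset α)),
      List.Forall₂ (fun r U => ∃ r' ∈ A.accept, A.Run r U r' ∧ P r U r') l L →
      q' ∈ A.γ q (l : Multiset Q) → P q (Pomset.parList L) q')
    {q q' : Q} {U : Pomset α} (h : A.Run q U q') : P q U q' := by
  induction h with
  | trivial q => exact trivial q
  | letter h => exact letter h
  | comp h₁ h₂ ih₁ ih₂ => exact comp ih₁ ih₂ h₁ h₂
  | fork r r' U h hacc hγ ih =>
    exact fork _ _ (List.forall₂_ofFn fun i => ⟨r' i, hacc i, h i, ih i⟩) hγ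

theorem Run.seriesParallel {A : PomsetAutomaton α Q} {q q' : Q} {U : Pomset α}
    (h : A.Run q U q') : U.SeriesParallel := by
  refine h.listInduction (P := fun _ U _ => U.SeriesParallel) (fun _ => .empty) (fun _ => .prim _)
    (fun h₁ h₂ _ _ => .seq h₁ h₂) fun l L h _ => .parList fun U hU => ?_
  obtain ⟨i, hi, rfl⟩ := List.mem_iff_getElem.1 hU
  obtain ⟨hlen, h⟩ := List.forall₂_iff_get.1 h
  obtain ⟨_, _, _, h⟩ := h i (hlen ▸ hi) hi
  exact h

theorem mem_language {A : PomsetAutomaton α Q} {q : Q} {U : Pomset α} :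
    U ∈ A.language q ↔ A.Accepts q U :=
  ⟨fun h => h.2, fun h => ⟨h.choose_spec.2.seriesParallel, h⟩⟩

/-- `R` is a simulation of `A` by `B`. -/
structure Simulation (A : PomsetAutomaton α Q) (B : PomsetAutomaton α Q') (R : Q → Q' → Prop) :
    Prop where
  accept : ∀ {q p}, R q p → q ∈ A.accept → p ∈ B.accept
  δ : ∀ {q p q' a}, R q p → q' ∈ A.δ q a → ∃ p', R q' p' ∧ p' ∈ B.δ p a
  γ : ∀ {q p q'} {l : List Q}, R q p → q' ∈ A.γ q (l : Multiset Q) →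
    ∃ (l' : List Q') (p' : Q'),
      List.Forall₂ R l l' ∧ R q' p' ∧ p' ∈ B.γ p (l' : Multiset Q')

theorem Simulation.run {A : PomsetAutomaton α Q} {B : PomsetAutomaton α Q'} {R : Q → Q' → Prop}
    (hR : Simulation A B R) {q q' : Q} {U : Pomset α} (h : A.Run q U q') :
    ∀ {p}, R q p → ∃ p', R q' p' ∧ B.Run p U p' := by
  refine h.listInduction (P := fun q U q' => ∀ {p}, R q p → ∃ p', R q' p' ∧ B.Run p U p')
    (fun q p hp => ⟨p, hp, .trivial p⟩) ?_ ?_ ?_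
  · intro q q' a h p hp
    obtain ⟨p', hp', h'⟩ := hR.δ hp h
    exact ⟨p', hp', .letter h'⟩
  · intro q q' q'' U V ih₁ ih₂ _ _ p hp
    obtain ⟨p₁, hp₁, h₁⟩ := ih₁ hp
    obtain ⟨p₂, hp₂, h₂⟩ := ih₂ hp₁
    exact ⟨p₂, hp₂, h₁.comp h₂⟩
  · intro q q' l L h hγ p hp
    obtain ⟨l', p', hl, hp', hγ'⟩ := hR.γ hp hγ
    refine ⟨p', hp', .forkList ?_ hγ'⟩
    clear hγ hγ'
    induction h generalizing l' with
    | nil => cases hl; exact .nil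
    | cons h _ ih =>
      obtain _ | ⟨hr, hl⟩ := hl
      obtain ⟨r', hacc, _, h⟩ := h
      obtain ⟨s, hs, hrun⟩ := h hr
      exact .cons ⟨s, hR.accept hs hacc, hrun⟩ (ih _ hl)

theorem Simulation.language_subset {A : PomsetAutomaton α Q} {B : PomsetAutomaton α Q'}
    {R : Q → Q' → Prop} (hR : Simulation A B R) {q : Q} {p : Q'} (hq : R q p) :
    A.language q ⊆ B.language p := by
  intro U hU
  obtain ⟨q', hacc, h⟩ := hU.2
  obtain ⟨p', hp', h'⟩ := hR.run h hq
  exact mem_language.2 ⟨p', hR.accept hp' hacc, h'⟩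

/-- A level function: levels do not increase along steps, and decrease at fork targets. -/
structure IsLevel (A : PomsetAutomaton α Q) (ℓ : Q → ℕ) : Prop where
  δ_le : ∀ {q q' a}, q' ∈ A.δ q a → ℓ q' ≤ ℓ q
  γ_le : ∀ {q q' φ}, q' ∈ A.γ q φ → ℓ q' ≤ ℓ q
  lt : ∀ {q r φ}, r ∈ φ → (A.γ q φ).Nonempty → ℓ r < ℓ q

theorem IsLevel.forkAcyclic {A : PomsetAutomaton α Q} {ℓ : Q → ℕ} (h : A.IsLevel ℓ) :
    A.ForkAcyclic := by
  have mono : ∀ {q q'}, A.Supports q' q → ℓ q' ≤ ℓ q := by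
    intro q q' hs
    induction hs with
    | refl => exact le_rfl
    | tail _ hstep ih =>
      refine ih.trans ?_
      cases hstep with
      | seq h' => exact h.δ_le h'
      | join h' => exact h.γ_le h'
      | target h₁ h₂ => exact (h.lt h₁ h₂).le
  intro q r φ hr hφ
  exact ⟨.single (.target hr hφ), fun hs => (h.lt hr hφ).not_ge (mono hs)⟩

theorem IsLevel.run_le {A : PomsetAutomaton α Q} {ℓ : Q → ℕ} (h : A.IsLevel ℓ) {q q' : Q}
    {U : Pomset α} (hr : A.Run q U q') : ℓ q' ≤ ℓ q := by
  induction hr with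
  | trivial => exact le_rfl
  | letter h' => exact h.δ_le h'
  | comp _ _ h₁ h₂ => exact h₂.trans h₁
  | fork _ _ _ _ _ hγ => exact h.γ_le hγ

theorem ForkAcyclic.exists_isLevel [Finite Q] {A : PomsetAutomaton α Q} (h : A.ForkAcyclic) :
    ∃ ℓ : Q → ℕ, A.IsLevel ℓ ∧ (∀ q, 0 < ℓ q) ∧ ∀ q, ℓ q ≤ Nat.card Q := by
  have mono : ∀ {q q'}, A.Supports q' q →
      {p | A.Supports p q'}.ncard ≤ {p | A.Supports p q}.ncard := fun hs =>
    Set.ncard_le_ncard (fun p hp => Relation.ReflTransGen.trans hp hs)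
  refine ⟨fun q => {p | A.Supports p q}.ncard, ⟨fun h' => mono (.single (.seq h')),
    fun h' => mono (.single (.join h')), fun hr hφ => ?_⟩, fun q => ?_, fun q => ?_⟩
  · obtain ⟨h₁, h₂⟩ := h _ _ _ hr hφ
    exact Set.ncard_lt_ncard ⟨fun p hp => Relation.ReflTransGen.trans hp h₁,
      fun hsub => h₂ (hsub Relation.ReflTransGen.refl)⟩
  · exact (Set.ncard_pos).2 ⟨q, Relation.ReflTransGen.refl⟩
  · exact Set.ncard_le_card _

end PomsetAutomaton

theorem List.Forall₂.exists_of_append {β : Type u} {γ : Type v} {R : β → γ → Prop} {l₁ l₂ : List β}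
    {L : List γ} (h : List.Forall₂ R (l₁ ++ l₂) L) :
    ∃ L₁ L₂, List.Forall₂ R l₁ L₁ ∧ List.Forall₂ R l₂ L₂ ∧ L = L₁ ++ L₂ := by
  induction l₁ generalizing L with
  | nil => exact ⟨[], L, .nil, h, rfl⟩
  | cons a l ih =>
    obtain _ | ⟨ha, h⟩ := h
    obtain ⟨L₁, L₂, h₁, h₂, rfl⟩ := ih h
    exact ⟨_ :: L₁, L₂, .cons ha h₁, h₂, rfl⟩

theorem List.Forall₂.append {β : Type u} {γ : Type v} {R : β → γ → Prop} {l₁ l₂ : List β}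
    {L₁ L₂ : List γ} (h₁ : List.Forall₂ R l₁ L₁) (h₂ : List.Forall₂ R l₂ L₂) :
    List.Forall₂ R (l₁ ++ l₂) (L₁ ++ L₂) := by
  induction h₁ with
  | nil => exact h₂
  | cons h _ ih => exact .cons h ih

namespace PomsetAutomaton

variable {α : Type u} {Q : Type v}

/-- A stack of states reads the sequential compositions of what its members accept. -/
def StackAccepts (A : PomsetAutomaton α Q) : List Q → Pomset α → Prop
  | [], U => U = Pomset.empty
  | q :: x, U => ∃ V W, A.Accepts q V ∧ A.StackAccepts x W ∧ U = Pomset.seq V W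

theorem stackAccepts_singleton {A : PomsetAutomaton α Q} {q : Q} {U : Pomset α} :
    A.StackAccepts [q] U ↔ A.Accepts q U := by
  constructor
  · rintro ⟨V, W, hV, rfl, rfl⟩
    simpa using hV
  · exact fun h => ⟨U, Pomset.empty, h, rfl, by simp⟩

/-- Reading a parallel composition of pomsets accepted by the states in `ψ` is a sound way to
replace the stack `x` by the stack `y`; moreover levels do not increase on the way. -/
structure StackMove (A : PomsetAutomaton α Q) (ℓ : Q → ℕ) (d b : ℕ) (x ψ y : List Q) : Prop where
  length_left : x.length ≤ d
  width : ψ.length ≤ b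
  length_right : y.length ≤ d
  accepts : ∀ L V, List.Forall₂ A.Accepts ψ L → A.StackAccepts y V →
    A.StackAccepts x (Pomset.seq (Pomset.parList L) V)
  level_right : ∀ s ∈ y, ∃ t ∈ x, ℓ s ≤ ℓ t
  level : ∀ s ∈ ψ, ∃ t ∈ x, ℓ s ≤ ℓ t
  level_lt : 2 ≤ ψ.length → ∀ s ∈ ψ, ∃ t ∈ x, ℓ s < ℓ t

/-- The closure properties that make a relation between stacks rich enough to simulate `A`, for
stacks of length at most `d` and forks of size at most `b`. -/
structure MoveClosed (A : PomsetAutomaton α Q) (d b : ℕ) (M : List Q → List Q → List Q → Prop) :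
    Prop where
  refl : ∀ {x}, x.length ≤ d → M x [] x
  trans_left : ∀ {x ψ y z}, M x [] y → M y ψ z → M x ψ z
  trans_right : ∀ {x ψ y z}, M x ψ y → M y [] z → M x ψ z
  call : ∀ {x r y}, M x [r] y → y.length + 1 ≤ d → M x [] (r :: y)
  ret : ∀ {f y}, f ∈ A.accept → y.length + 1 ≤ d → M (f :: y) [] y
  atom : ∀ {r y}, y.length + 1 ≤ d → M (r :: y) [r] y
  fork : ∀ {q q' φ}, q' ∈ A.γ q φ → ∃ l : List Q, (l : Multiset Q) = φ ∧ ∀ y ψs,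
    y.length + 1 ≤ d → ψs.flatten.length ≤ b → List.Forall₂ (fun r ψ => M [r] ψ []) l ψs →
      M (q :: y) ψs.flatten (q' :: y)

namespace StackMove

variable {A : PomsetAutomaton α Q} {ℓ : Q → ℕ} {d b : ℕ}

theorem refl {x : List Q} (hx : x.length ≤ d) : StackMove A ℓ d b x [] x where
  length_left := hx
  width := by simp
  length_right := hx
  accepts := by
    rintro _ V ⟨⟩ hV
    simpa using hV
  level_right s hs := ⟨s, hs, le_rfl⟩
  level := by simp
  level_lt := by simp

theorem trans_left {x ψ y z : List Q} (h₁ : StackMove A ℓ d b x [] y)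
    (h₂ : StackMove A ℓ d b y ψ z) : StackMove A ℓ d b x ψ z where
  length_left := h₁.length_left
  width := h₂.width
  length_right := h₂.length_right
  accepts L V hL hV := by simpa using h₁.accepts [] _ .nil (h₂.accepts L V hL hV)
  level_right s hs := by
    obtain ⟨t, ht, h⟩ := h₂.level_right s hs
    obtain ⟨t', ht', h'⟩ := h₁.level_right t ht
    exact ⟨t', ht', h.trans h'⟩
  level s hs := by
    obtain ⟨t, ht, h⟩ := h₂.level s hs
    obtain ⟨t', ht', h'⟩ := h₁.level_right t ht
    exact ⟨t', ht', h.trans h'⟩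
  level_lt hψ s hs := by
    obtain ⟨t, ht, h⟩ := h₂.level_lt hψ s hs
    obtain ⟨t', ht', h'⟩ := h₁.level_right t ht
    exact ⟨t', ht', h.trans_le h'⟩

theorem trans_right {x ψ y z : List Q} (h₁ : StackMove A ℓ d b x ψ y)
    (h₂ : StackMove A ℓ d b y [] z) : StackMove A ℓ d b x ψ z where
  length_left := h₁.length_left
  width := h₁.width
  length_right := h₂.length_right
  accepts L V hL hV := by simpa using h₁.accepts L _ hL (h₂.accepts [] V .nil hV)
  level_right s hs := by
    obtain ⟨t, ht, h⟩ := h₂.level_right s hs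
    obtain ⟨t', ht', h'⟩ := h₁.level_right t ht
    exact ⟨t', ht', h.trans h'⟩
  level := h₁.level
  level_lt := h₁.level_lt

theorem call {x y : List Q} {r : Q} (h : StackMove A ℓ d b x [r] y) (hy : y.length + 1 ≤ d) :
    StackMove A ℓ d b x [] (r :: y) where
  length_left := h.length_left
  width := by simp
  length_right := hy
  accepts := by
    rintro _ _ ⟨⟩ ⟨V, W, hV, hW, rfl⟩
    simpa using h.accepts [V] W (.cons hV .nil) hW
  level_right s hs := by
    obtain rfl | hs := List.mem_cons.1 hs
    · exact h.level s (by simp)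
    · exact h.level_right s hs
  level := by simp
  level_lt := by simp

theorem ret {y : List Q} {f : Q} (hf : f ∈ A.accept) (hy : y.length + 1 ≤ d) :
    StackMove A ℓ d b (f :: y) [] y where
  length_left := hy
  width := by simp
  length_right := by omega
  accepts := by
    rintro _ V ⟨⟩ hV
    exact ⟨Pomset.empty, V, ⟨f, hf, .trivial f⟩, hV, rfl⟩
  level_right s hs := ⟨s, by simp [hs], le_rfl⟩
  level := by simp
  level_lt := by simp

theorem atom (hb : 1 ≤ b) {y : List Q} {r : Q} (hy : y.length + 1 ≤ d) :
    StackMove A ℓ d b (r :: y) [r] y where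
  length_left := hy
  width := by simpa using hb
  length_right := by omega
  accepts := by
    rintro _ V (_ | ⟨hU, ⟨⟩⟩) hV
    exact ⟨_, V, hU, hV, by simp⟩
  level_right s hs := ⟨s, by simp [hs], le_rfl⟩
  level s hs := ⟨r, by simp, by simp_all⟩
  level_lt := by simp

theorem exists_level_le {l : List Q} {ψs : List (List Q)}
    (h : List.Forall₂ (fun r ψ => StackMove A ℓ d b [r] ψ []) l ψs) {s : Q}
    (hs : s ∈ ψs.flatten) : ∃ r ∈ l, ℓ s ≤ ℓ r := by
  obtain ⟨ψ, hψ, hs⟩ := List.mem_flatten.1 hs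
  obtain ⟨i, hi, rfl⟩ := List.mem_iff_getElem.1 hψ
  obtain ⟨hlen, h⟩ := List.forall₂_iff_get.1 h
  obtain ⟨t, ht, hst⟩ := (h i (hlen ▸ hi) hi).level s hs
  have ht : t = l[i] := by simpa using ht
  exact ⟨t, by simp [ht], hst⟩

theorem fork (hℓ : A.IsLevel ℓ) {y l : List Q} {q q' : Q} {ψs : List (List Q)}
    (hq : q' ∈ A.γ q (l : Multiset Q)) (hy : y.length + 1 ≤ d) (hb : ψs.flatten.length ≤ b)
    (h : List.Forall₂ (fun r ψ => StackMove A ℓ d b [r] ψ []) l ψs) :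
    StackMove A ℓ d b (q :: y) ψs.flatten (q' :: y) := by
  have hlt : ∀ s ∈ ψs.flatten, ℓ s < ℓ q := by
    intro s hs
    obtain ⟨r, hr, hsr⟩ := exists_level_le h hs
    exact hsr.trans_lt (hℓ.lt (φ := l) (by simpa using hr) ⟨q', hq⟩)
  refine ⟨hy, hb, hy, ?_, ?_, fun s hs => ⟨q, by simp, (hlt s hs).le⟩,
    fun _ s hs => ⟨q, by simp, hlt s hs⟩⟩
  · rintro L _ hL ⟨V, W, ⟨f, hf, hV⟩, hW, rfl⟩
    have : ∃ L', List.Forall₂ A.Accepts l L' ∧ Pomset.parList L' = Pomset.parList L := by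
      clear hb hlt hq
      induction h generalizing L with
      | nil => cases hL; exact ⟨[], .nil, rfl⟩
      | cons h _ ih =>
        obtain ⟨L₁, L₂, h₁, h₂, rfl⟩ := hL.exists_of_append
        obtain ⟨L', hL', h'⟩ := ih _ h₂
        refine ⟨Pomset.parList L₁ :: L', .cons ?_ hL', by simp [h', Pomset.parList_append]⟩
        simpa [stackAccepts_singleton] using h.accepts L₁ Pomset.empty h₁ rfl
    obtain ⟨L', hL', h'⟩ := this
    exact ⟨Pomset.seq (Pomset.parList L) V, W, ⟨f, hf, (h' ▸ Run.forkList hL' hq).comp hV⟩, hW,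
      by rw [Pomset.seq_assoc]⟩
  · intro s hs
    obtain rfl | hs := List.mem_cons.1 hs
    · exact ⟨q, by simp, hℓ.γ_le hq⟩
    · exact ⟨s, by simp [hs], le_rfl⟩

theorem moveClosed (hℓ : A.IsLevel ℓ) (hb : 1 ≤ b) : A.MoveClosed d b (StackMove A ℓ d b) where
  refl := refl
  trans_left := trans_left
  trans_right := trans_right
  call := call
  ret := ret
  atom := atom hb
  fork {q q' φ} h := ⟨φ.toList, by simp, fun y ψs hy hψ hl =>
    fork hℓ (by simpa using h) hy hψ hl⟩

end StackMove

/-- The mode after a fork: `0` is the mode of fork targets, `1` is reached from it by a fork, and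
only states in mode `2` may accept. -/
def nextMode (m : ℕ) : ℕ := if m = 0 then 1 else 2

/-- The automaton whose states are a mode and a stack of states of `A`, and which moves along `M`. -/
def stackAutomaton [Finite Q] (A : PomsetAutomaton α Q) (M : List Q → List Q → List Q → Prop)
    (b : ℕ) (hM : ∀ {x ψ y}, M x ψ y → ψ.length ≤ b) : PomsetAutomaton α (ℕ × List Q) where
  accept := {p | p.1 = 2 ∧ M p.2 [] []}
  δ p a := {p' | ∃ q q' x, M p.2 [] (q :: x) ∧ q' ∈ A.δ q a ∧ p' = (2, q' :: x)}
  γ p φ := {p' | ∃ ψ y, M p.2 ψ y ∧ 2 ≤ ψ.length ∧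
    φ = (ψ.map fun s => (0, [s]) : List (ℕ × List Q)) ∧ p' = (nextMode p.1, y)}
  finite_forks p := by
    refine ((List.finite_length_le Q b).image
      fun ψ => ((ψ.map fun s => (0, [s]) : List (ℕ × List Q)) : Multiset (ℕ × List Q))).subset ?_
    rintro φ ⟨p', ψ, y, h, -, rfl, -⟩
    exact ⟨ψ, hM h, rfl⟩

section stackLevel

variable {A : PomsetAutomaton α Q} {ℓ : Q → ℕ} {d b : ℕ}

/-- The level of a stack is the maximal level of its members. -/
def stackLevel (ℓ : Q → ℕ) (x : List Q) : ℕ := (x.map ℓ).foldr max 0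

theorem stackLevel_le {x : List Q} {c : ℕ} : stackLevel ℓ x ≤ c ↔ ∀ s ∈ x, ℓ s ≤ c := by
  induction x with
  | nil => simp [stackLevel]
  | cons s x ih =>
    rw [List.forall_mem_cons, ← ih]
    simp [stackLevel]

theorem le_stackLevel {x : List Q} {s : Q} (h : s ∈ x) : ℓ s ≤ stackLevel ℓ x :=
  stackLevel_le.1 le_rfl s h

theorem StackMove.stackLevel_le {x ψ y : List Q} (h : StackMove A ℓ d b x ψ y) :
    stackLevel ℓ y ≤ stackLevel ℓ x := by
  refine PomsetAutomaton.stackLevel_le.2 fun s hs => ?_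
  obtain ⟨t, ht, hst⟩ := h.level_right s hs
  exact hst.trans (le_stackLevel ht)

end stackLevel

section stackAutomaton

variable [Finite Q] {A : PomsetAutomaton α Q} {M : List Q → List Q → List Q → Prop} {ℓ : Q → ℕ}
  {d b : ℕ} {hM : ∀ {x ψ y}, M x ψ y → ψ.length ≤ b}

theorem stackAutomaton_wellStructured : (stackAutomaton A M b hM).WellStructured := by
  rintro p φ ⟨p', ψ, y, h, hψ, rfl, -⟩
  refine ⟨by simpa using hψ, fun r hr => ?_⟩
  obtain ⟨s, -, rfl⟩ : ∃ s ∈ ψ, (0, [s]) = r := by simpa using hr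
  refine ⟨fun hacc => absurd hacc.1 (by simp), fun φ' => ?_⟩
  ext r'
  simp only [Set.mem_inter_iff, Set.mem_empty_iff_false, iff_false]
  rintro ⟨⟨ψ', y', -, -, -, rfl⟩, hacc⟩
  exact absurd hacc.1 (by simp [nextMode])

theorem stackAutomaton_isLevel (hℓ : A.IsLevel ℓ)
    (hle : ∀ {x ψ y}, M x ψ y → StackMove A ℓ d b x ψ y) :
    (stackAutomaton A M b hM).IsLevel fun p => stackLevel ℓ p.2 where
  δ_le := by
    rintro p _ a ⟨q, q', x, h, hq, rfl⟩
    refine le_trans (stackLevel_le.2 fun s hs => ?_) (hle h).stackLevel_le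
    obtain rfl | hs := List.mem_cons.1 hs
    · exact (hℓ.δ_le hq).trans (le_stackLevel (by simp))
    · exact le_stackLevel (by simp [hs])
  γ_le := by
    rintro p _ φ ⟨ψ, y, h, -, -, rfl⟩
    exact (hle h).stackLevel_le
  lt := by
    rintro p r φ hr ⟨p', ψ, y, h, hψ, rfl, -⟩
    obtain ⟨s, hs, rfl⟩ : ∃ s ∈ ψ, (0, [s]) = r := by simpa using hr
    obtain ⟨t, ht, hst⟩ := (hle h).level_lt hψ s hs
    simpa [stackLevel] using hst.trans_le (le_stackLevel ht)

theorem stackAutomaton_run_sound (hle : ∀ {x ψ y}, M x ψ y → StackMove A ℓ d b x ψ y)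
    {p p' : ℕ × List Q} {U : Pomset α} (h : (stackAutomaton A M b hM).Run p U p') :
    ∀ {V}, A.StackAccepts p'.2 V → A.StackAccepts p.2 (Pomset.seq U V) := by
  refine h.listInduction (P := fun p U p' => ∀ {V}, A.StackAccepts p'.2 V →
    A.StackAccepts p.2 (Pomset.seq U V)) (fun p V hV => by simpa using hV) ?_ ?_ ?_
  · rintro p _ a ⟨q, q', x, h, hq, rfl⟩ _ ⟨V, W, ⟨f, hf, hV⟩, hW, rfl⟩
    simpa using (hle h).accepts [] _ .nil
      ⟨Pomset.seq (Pomset.prim a) V, W, ⟨f, hf, (Run.letter hq).comp hV⟩, hW,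
        (Pomset.seq_assoc _ _ _).symm⟩
  · intro p p' p'' U V ih₁ ih₂ _ _ W hW
    rw [Pomset.seq_assoc]
    exact ih₁ (ih₂ hW)
  · rintro p _ l L hL ⟨ψ, y, h, -, hl, rfl⟩ V hV
    obtain ⟨L', hL', hp⟩ := List.perm_comp_forall₂ (Multiset.coe_eq_coe.1 hl).symm hL
    rw [← Pomset.parList_perm hp]
    refine (hle h).accepts L' V ?_ hV
    rw [List.forall₂_map_left_iff] at hL'
    refine hL'.imp fun s U hU => ?_
    obtain ⟨r', hacc, -, hU⟩ := hU
    have := hU (V := Pomset.empty) (by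
      simpa using (hle hacc.2).accepts [] Pomset.empty .nil rfl)
    simpa [stackAccepts_singleton] using this

theorem stackAutomaton_accepts_sound (hle : ∀ {x ψ y}, M x ψ y → StackMove A ℓ d b x ψ y)
    {m : ℕ} {q : Q} {U : Pomset α} (h : (stackAutomaton A M b hM).Accepts (m, [q]) U) :
    A.Accepts q U := by
  obtain ⟨p', hacc, h⟩ := h
  have := stackAutomaton_run_sound hle h (V := Pomset.empty) (by
      simpa using (hle hacc.2).accepts [] Pomset.empty .nil rfl)
  simpa [stackAccepts_singleton] using this

end stackAutomaton

end PomsetAutomaton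

theorem List.length_flatten_le {β : Type u} {L : List (List β)} {c : ℕ}
    (h : ∀ l ∈ L, l.length ≤ c) : L.flatten.length ≤ L.length * c := by
  induction L with
  | nil => simp
  | cons l L ih =>
    have h₁ := h l (by simp)
    have h₂ := ih fun l' hl' => h l' (by simp [hl'])
    simp only [List.flatten_cons, List.length_append, List.length_cons, Nat.add_mul, Nat.one_mul]
    omega

namespace PomsetAutomaton

variable {α : Type u} {Q : Type v}

/-- From every stack with `q` on top, the stack automaton can read `U` while it replaces `q` by
the states in `y'`. -/
def Unfolds (B : PomsetAutomaton α (ℕ × List Q)) (M : List Q → List Q → List Q → Prop)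
    (ℓ : Q → ℕ) (d : ℕ) (q : Q) (U : Pomset α) (y' : List Q) : Prop :=
  ∀ y m, y.length + ℓ q ≤ d → ∃ z, B.Run (m, q :: y) U (2, z) ∧ M z [] (y' ++ y)

/-- `U` is a parallel composition of pomsets that the states in `ψ` read in the stack automaton. -/
def Realizes (B : PomsetAutomaton α (ℕ × List Q)) (M : List Q → List Q → List Q → Prop)
    (ℓ : Q → ℕ) (d : ℕ) (ψ : List Q) (U : Pomset α) : Prop :=
  ∃ L, List.Forall₂ (fun s V => Unfolds B M ℓ d s V []) ψ L ∧ U = Pomset.parList L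

/-- A run of `A` either is a single move, or is simulated by a run of the stack automaton. -/
def Unfoldable (B : PomsetAutomaton α (ℕ × List Q)) (M : List Q → List Q → List Q → Prop)
    (ℓ : Q → ℕ) (d K : ℕ) (q : Q) (U : Pomset α) (q' : Q) : Prop :=
  (∃ ψ : List Q, ψ.length ≠ 1 ∧ ψ.length ≤ K ^ ℓ q ∧ Realizes B M ℓ d ψ U ∧
    ∀ y : List Q, y.length + ℓ q ≤ d → M (q :: y) ψ (q' :: y)) ∨ Unfolds B M ℓ d q U [q']

theorem Realizes.append {M : List Q → List Q → List Q → Prop} {ℓ : Q → ℕ} {d : ℕ}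
    {B : PomsetAutomaton α (ℕ × List Q)} {ψ ψ' : List Q}
    {U V : Pomset α} (h : Realizes B M ℓ d ψ U) (h' : Realizes B M ℓ d ψ' V) :
    Realizes B M ℓ d (ψ ++ ψ') (Pomset.par U V) := by
  obtain ⟨L, hL, rfl⟩ := h
  obtain ⟨L', hL', rfl⟩ := h'
  exact ⟨L ++ L', hL.append hL', by rw [Pomset.parList_append]⟩

section completeness

variable [Finite Q] {A : PomsetAutomaton α Q} {M : List Q → List Q → List Q → Prop} {ℓ : Q → ℕ}
  {d b K : ℕ} {hM : ∀ {x ψ y}, M x ψ y → ψ.length ≤ b}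

theorem stackAutomaton_run_absorb (hcl : A.MoveClosed d b M)
    (hle : ∀ {x ψ y}, M x ψ y → y.length ≤ d)
    {p p' : ℕ × List Q} {U : Pomset α} (h : (stackAutomaton A M b hM).Run p U p') :
    ∀ {x}, M x [] p.2 → ∃ z, (stackAutomaton A M b hM).Run (p.1, x) U (p'.1, z) ∧ M z [] p'.2 := by
  refine h.listInduction (P := fun p U p' => ∀ {x}, M x [] p.2 →
      ∃ z, (stackAutomaton A M b hM).Run (p.1, x) U (p'.1, z) ∧ M z [] p'.2) ?_ ?_ ?_ ?_
  · exact fun q x hx => ⟨x, .trivial _, hx⟩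
  · rintro p _ a ⟨q, q', y, h, hq, rfl⟩ x hx
    exact ⟨_, .letter ⟨q, q', y, hcl.trans_left hx h, hq, rfl⟩, hcl.refl (hle h :)⟩
  · intro p p' p'' U V ih₁ ih₂ _ _ x hx
    obtain ⟨z, hz, hzp⟩ := ih₁ hx
    obtain ⟨z', hz', hzw⟩ := ih₂ hzp
    exact ⟨z', hz.comp hz', hzw⟩
  · rintro p _ l L hL ⟨ψ, y, h, hψ, hl, rfl⟩ x hx
    refine ⟨_, .forkList (hL.imp fun s U hU => ?_)
      ⟨ψ, y, hcl.trans_left hx h, hψ, hl, rfl⟩, hcl.refl (hle h)⟩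
    obtain ⟨r', hacc, hU, -⟩ := hU
    exact ⟨r', hacc, hU⟩

theorem stackAutomaton_fork (hℓd : ∀ q, ℓ q ≤ d) {ψ x y : List Q} {U : Pomset α} (m : ℕ)
    (hU : Realizes (stackAutomaton A M b hM) M ℓ d ψ U) (hψ : 2 ≤ ψ.length) (h : M x ψ y) :
    (stackAutomaton A M b hM).Run (m, x) U (nextMode m, y) := by
  obtain ⟨L, hL, rfl⟩ := hU
  refine .forkList (l := ψ.map fun s => (0, [s])) ?_ ⟨ψ, y, h, hψ, rfl, rfl⟩
  rw [List.forall₂_map_left_iff]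
  refine hL.imp fun s U hU => ?_
  obtain ⟨z, hz, hz'⟩ := hU [] 0 (by simpa using hℓd s)
  exact ⟨(2, z), ⟨rfl, by simpa using hz'⟩, hz⟩

theorem Unfoldable.comp (hcl : A.MoveClosed d b M) (hle : ∀ {x ψ y}, M x ψ y → y.length ≤ d)
    (hℓd : ∀ q, ℓ q ≤ d) (hK : 0 < K) {q q' q'' : Q} {U V : Pomset α} (hq : ℓ q'' ≤ ℓ q)
    (h₁ : Unfoldable (stackAutomaton A M b hM) M ℓ d K q U q'')
    (h₂ : Unfoldable (stackAutomaton A M b hM) M ℓ d K q'' V q') :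
    Unfoldable (stackAutomaton A M b hM) M ℓ d K q (Pomset.seq U V) q' := by
  rcases h₁ with ⟨ψ₁, hn₁, hw₁, hr₁, hm₁⟩ | h₁ <;> rcases h₂ with ⟨ψ₂, hn₂, hw₂, hr₂, hm₂⟩ | h₂
  · rcases eq_or_ne ψ₁ [] with rfl | hψ₁
    · obtain ⟨_, ⟨⟩, rfl⟩ := hr₁
      refine .inl ⟨ψ₂, hn₂, hw₂.trans (Nat.pow_le_pow_right hK hq), by simpa using hr₂,
        fun y hy => hcl.trans_left (hm₁ y hy) (hm₂ y (by omega))⟩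
    rcases eq_or_ne ψ₂ [] with rfl | hψ₂
    · obtain ⟨_, ⟨⟩, rfl⟩ := hr₂
      refine .inl ⟨ψ₁, hn₁, hw₁, by simpa using hr₁,
        fun y hy => hcl.trans_right (hm₁ y hy) (hm₂ y (by omega))⟩
    have hl₁ : 2 ≤ ψ₁.length := by have := List.length_pos_iff.2 hψ₁; omega
    have hl₂ : 2 ≤ ψ₂.length := by have := List.length_pos_iff.2 hψ₂; omega
    refine .inr fun y m hy => ⟨q' :: y, ?_, hcl.refl (hle (hm₂ y (by omega)))⟩
    have hmode : nextMode (nextMode m) = 2 := by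
      unfold nextMode; split_ifs <;> simp_all
    exact hmode ▸ (stackAutomaton_fork hℓd m hr₁ hl₁ (hm₁ y hy)).comp
      (stackAutomaton_fork hℓd (nextMode m) hr₂ hl₂ (hm₂ y (by omega)))
  · refine .inr fun y m hy => ?_
    rcases eq_or_ne ψ₁ [] with rfl | hψ₁
    · obtain ⟨_, ⟨⟩, rfl⟩ := hr₁
      obtain ⟨z, hz, hz'⟩ := h₂ y m (by omega)
      obtain ⟨z₁, hz₁, h'⟩ := stackAutomaton_run_absorb hcl hle hz (hm₁ y hy)
      exact ⟨z₁, by simpa using hz₁, hcl.trans_right h' hz'⟩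
    have hl₁ : 2 ≤ ψ₁.length := by have := List.length_pos_iff.2 hψ₁; omega
    obtain ⟨z, hz, hz'⟩ := h₂ y (nextMode m) (by omega)
    exact ⟨z, (stackAutomaton_fork hℓd m hr₁ hl₁ (hm₁ y hy)).comp hz, hz'⟩
  · refine .inr fun y m hy => ?_
    obtain ⟨z, hz, hz'⟩ := h₁ y m hy
    rcases eq_or_ne ψ₂ [] with rfl | hψ₂
    · obtain ⟨_, ⟨⟩, rfl⟩ := hr₂
      exact ⟨z, by simpa using hz, hcl.trans_right hz' (hm₂ y (by omega))⟩
    have hl₂ : 2 ≤ ψ₂.length := by have := List.length_pos_iff.2 hψ₂; omega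
    have hm := hcl.trans_left hz' (hm₂ y (by omega))
    exact ⟨q' :: y, hz.comp (stackAutomaton_fork hℓd 2 hr₂ hl₂ hm), hcl.refl (hle hm)⟩
  · refine .inr fun y m hy => ?_
    obtain ⟨z, hz, hz'⟩ := h₁ y m hy
    obtain ⟨z₂, hz₂, hz₂'⟩ := h₂ y 2 (by omega)
    obtain ⟨z₁, hz₁, h'⟩ := stackAutomaton_run_absorb hcl hle hz₂ hz'
    exact ⟨z₁, hz.comp hz₁, hcl.trans_right h' hz₂'⟩

theorem Unfoldable.exists_realizes (hcl : A.MoveClosed d b M) (hℓ0 : ∀ q, 0 < ℓ q)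
    (hℓd : ∀ q, ℓ q ≤ d) (hK : 0 < K) {r r' : Q} {U : Pomset α} (hr' : r' ∈ A.accept)
    (h : Unfoldable (stackAutomaton A M b hM) M ℓ d K r U r') :
    ∃ ψ, Realizes (stackAutomaton A M b hM) M ℓ d ψ U ∧ ψ.length ≤ K ^ ℓ r ∧ M [r] ψ [] := by
  have hd : 1 ≤ d := (hℓ0 r).trans_le (hℓd r)
  rcases h with ⟨ψ, -, hw, hr, hm⟩ | h
  · exact ⟨ψ, hr, hw, hcl.trans_right (hm [] (by simpa using hℓd r)) (hcl.ret hr' (by simpa))⟩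
  · refine ⟨[r], ⟨[U], .cons (fun y m hy => ?_) .nil, by simp⟩, Nat.one_le_pow _ _ hK,
      hcl.atom (by simpa)⟩
    obtain ⟨z, hz, hz'⟩ := h y m hy
    have := hℓ0 r
    exact ⟨z, hz, hcl.trans_right hz' (hcl.ret hr' (by
      change y.length + 1 ≤ d
      omega))⟩

theorem Unfoldable.fork (hcl : A.MoveClosed d b M) (hle : ∀ {x ψ y}, M x ψ y → StackMove A ℓ d b x ψ y)
    (hA : A.IsLevel ℓ) (hℓ0 : ∀ q, 0 < ℓ q) (hℓd : ∀ q, ℓ q ≤ d)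
    (hK : 0 < K) (hKb : K ^ d ≤ b)
    (hAK : ∀ q φ, (A.γ q φ).Nonempty → φ.card ≤ K) {q q' : Q} {l : List Q} {L : List (Pomset α)}
    (h : List.Forall₂ (fun r U => ∃ r' ∈ A.accept,
      Unfoldable (stackAutomaton A M b hM) M ℓ d K r U r') l L)
    (hq : q' ∈ A.γ q (l : Multiset Q)) :
    Unfoldable (stackAutomaton A M b hM) M ℓ d K q (Pomset.parList L) q' := by
  obtain ⟨l', hl', hfork⟩ := hcl.fork hq
  obtain ⟨L', hL', hp⟩ := List.perm_comp_forall₂ (Multiset.coe_eq_coe.1 hl') h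
  rw [← Pomset.parList_perm hp]
  have hlt : ∀ r ∈ l', ℓ r < ℓ q := fun r hr =>
    hA.lt (φ := l) (by rw [← hl']; simpa using hr) ⟨q', hq⟩
  have hcard : l'.length ≤ K := by simpa [← hl'] using hAK q l ⟨q', hq⟩
  have key : ∃ ψs : List (List Q), List.Forall₂ (fun r ψ => M [r] ψ []) l' ψs ∧
      (∀ ψ ∈ ψs, ψ.length ≤ K ^ (ℓ q - 1)) ∧
      Realizes (stackAutomaton A M b hM) M ℓ d ψs.flatten (Pomset.parList L') := by
    clear hfork hp h hq hl' hcard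
    induction hL' with
    | nil => exact ⟨[], .nil, by simp, [], .nil, rfl⟩
    | cons h _ ih =>
      obtain ⟨ψs, h₁, h₂, h₃⟩ := ih fun r hr => hlt r (by simp [hr])
      obtain ⟨r', hr', h⟩ := h
      obtain ⟨ψ, hψ, hw, hm⟩ := h.exists_realizes hcl hℓ0 hℓd hK hr'
      refine ⟨ψ :: ψs, .cons hm h₁, ?_, hψ.append h₃⟩
      rw [List.forall_mem_cons]
      exact ⟨hw.trans (Nat.pow_le_pow_right hK (Nat.le_sub_one_of_lt (hlt _ (by simp)))), h₂⟩
  obtain ⟨ψs, hψs, hw, hr⟩ := key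
  have hq0 := hℓ0 q
  have hwidth : ψs.flatten.length ≤ K ^ ℓ q := by
    refine (List.length_flatten_le hw).trans ?_
    rw [← hψs.length_eq]
    refine (Nat.mul_le_mul_right _ hcard).trans ?_
    rw [← Nat.pow_succ', Nat.succ_eq_add_one, Nat.sub_add_cancel hq0]
  have hmove : ∀ y : List Q, y.length + ℓ q ≤ d → M (q :: y) ψs.flatten (q' :: y) := fun y hy =>
    hfork y ψs (by omega) (hwidth.trans ((Nat.pow_le_pow_right hK (hℓd q)).trans hKb)) hψs
  by_cases h1 : ψs.flatten.length = 1
  · obtain ⟨s, hs⟩ := List.length_eq_one_iff.1 h1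
    rw [hs] at hr hmove
    obtain ⟨_, _ | ⟨hV, ⟨⟩⟩, hL⟩ := hr
    rw [hL]
    have hsq : ℓ s < ℓ q := by
      obtain ⟨r, hr', hsr⟩ := StackMove.exists_level_le (hψs.imp fun _ _ h => hle h) (s := s)
        (by simp [hs])
      exact hsr.trans_lt (hlt r hr')
    have hs0 := hℓ0 s
    refine .inr fun y m hy => ?_
    obtain ⟨z, hz, hz'⟩ := hV (q' :: y) m (by simp; omega)
    obtain ⟨z₁, hz₁, h'⟩ := stackAutomaton_run_absorb hcl (fun h => (hle h).length_right) hz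
      (hcl.call (hmove y hy) (by simp; omega))
    exact ⟨z₁, by simpa using hz₁, hcl.trans_right h' (by simpa using hz')⟩
  · exact .inl ⟨_, h1, hwidth, hr, hmove⟩

theorem unfoldable_of_run (hcl : A.MoveClosed d b M) (hle : ∀ {x ψ y}, M x ψ y → StackMove A ℓ d b x ψ y)
    (hA : A.IsLevel ℓ) (hℓ0 : ∀ q, 0 < ℓ q) (hℓd : ∀ q, ℓ q ≤ d)
    (hK : 0 < K) (hKb : K ^ d ≤ b) (hAK : ∀ q φ, (A.γ q φ).Nonempty → φ.card ≤ K)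
    {q q' : Q} {U : Pomset α} (h : A.Run q U q') :
    Unfoldable (stackAutomaton A M b hM) M ℓ d K q U q' := by
  have hlen : ∀ (q : Q) (y : List Q), y.length + ℓ q ≤ d → y.length + 1 ≤ d := fun q y hy => by
    have := hℓ0 q
    omega
  refine h.listInduction (P := Unfoldable (stackAutomaton A M b hM) M ℓ d K) ?_ ?_ ?_ ?_
  · exact fun q => .inl ⟨[], by simp, by simp, ⟨[], .nil, rfl⟩, fun y hy =>
      hcl.refl (by simpa using hlen q y hy)⟩
  · intro q q' a ha
    exact .inr fun y m hy => ⟨q' :: y, .letter ⟨q, q', y, hcl.refl (hlen q y hy), ha, rfl⟩,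
      hcl.refl (hlen q y hy)⟩
  · exact fun h₁ h₂ hr _ => h₁.comp hcl (fun h => (hle h).length_right) hℓd hK (hA.run_le hr) h₂
  · exact fun l L h hq => Unfoldable.fork hcl hle hA hℓ0 hℓd hK hKb hAK
      (h.imp fun r U ⟨r', hr', _, h'⟩ => ⟨r', hr', h'⟩) hq

theorem stackAutomaton_accepts_complete (hcl : A.MoveClosed d b M)
    (hle : ∀ {x ψ y}, M x ψ y → StackMove A ℓ d b x ψ y)
    (hA : A.IsLevel ℓ) (hℓ0 : ∀ q, 0 < ℓ q) (hℓd : ∀ q, ℓ q ≤ d)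
    (hK : 0 < K) (hKb : K ^ d ≤ b) (hAK : ∀ q φ, (A.γ q φ).Nonempty → φ.card ≤ K)
    {q : Q} {U : Pomset α} (h : A.Accepts q U) :
    (stackAutomaton A M b hM).Accepts (2, [q]) U := by
  obtain ⟨f, hf, h⟩ := h
  have hret : M [f] [] [] := hcl.ret hf ((hℓ0 f).trans_le (hℓd f))
  rcases unfoldable_of_run (hM := hM) hcl hle hA hℓ0 hℓd hK hKb hAK h with ⟨ψ, h1, hw, hr, hm⟩ | h
  · have hm := hm [] (by simpa using hℓd q)
    rcases eq_or_ne ψ [] with rfl | hψ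
    · obtain ⟨_, ⟨⟩, rfl⟩ := hr
      exact ⟨(2, [q]), ⟨rfl, hcl.trans_right hm hret⟩, .trivial _⟩
    · have hl : 2 ≤ ψ.length := by have := List.length_pos_iff.2 hψ; omega
      exact ⟨_, ⟨rfl, hret⟩, stackAutomaton_fork hℓd 2 hr hl hm⟩
  · obtain ⟨z, hz, hz'⟩ := h [] 2 (by simpa using hℓd q)
    exact ⟨(2, z), ⟨rfl, hcl.trans_right hz' hret⟩, hz⟩

theorem language_stackAutomaton (hcl : A.MoveClosed d b M)
    (hle : ∀ {x ψ y}, M x ψ y → StackMove A ℓ d b x ψ y)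
    (hA : A.IsLevel ℓ) (hℓ0 : ∀ q, 0 < ℓ q) (hℓd : ∀ q, ℓ q ≤ d)
    (hK : 0 < K) (hKb : K ^ d ≤ b) (hAK : ∀ q φ, (A.γ q φ).Nonempty → φ.card ≤ K) (q : Q) :
    (stackAutomaton A M b hM).language (2, [q]) = A.language q := by
  ext U
  rw [mem_language, mem_language]
  exact ⟨stackAutomaton_accepts_sound hle, stackAutomaton_accepts_complete hcl hle hA hℓ0 hℓd hK hKb hAK⟩

end completeness

end PomsetAutomaton

namespace PomsetAutomaton

variable {α : Type u} {Q : Type v} {Q' : Type w}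

/-- `e` maps the states of `A'` to states of `A` with the same behaviour. -/
structure IsCover (A' : PomsetAutomaton α Q') (A : PomsetAutomaton α Q) (e : Q' → Q) : Prop where
  accept : ∀ {q}, q ∈ A'.accept ↔ e q ∈ A.accept
  δ : ∀ {q q' a}, q' ∈ A'.δ q a → e q' ∈ A.δ (e q) a
  γ : ∀ {q q' φ}, q' ∈ A'.γ q φ → e q' ∈ A.γ (e q) (φ.map e)
  δ_lift : ∀ {q p a}, p ∈ A.δ (e q) a → ∃ q', e q' = p ∧ q' ∈ A'.δ q a
  γ_lift : ∀ {q p φ}, p ∈ A.γ (e q) φ → ∃ q' φ', e q' = p ∧ φ'.map e = φ ∧ q' ∈ A'.γ q φ'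

namespace IsCover

variable {A' : PomsetAutomaton α Q'} {A : PomsetAutomaton α Q} {e : Q' → Q}

theorem simulation (h : IsCover A' A e) : Simulation A' A fun q p => e q = p where
  accept := by
    rintro q _ rfl hq
    exact h.accept.1 hq
  δ := by
    rintro q _ q' a rfl hq
    exact ⟨_, rfl, h.δ hq⟩
  γ := by
    rintro q _ q' l rfl hq
    exact ⟨l.map e, _, List.forall₂_map_right_iff.2 (List.forall₂_same.2 fun _ _ => rfl), rfl,
      by simpa using h.γ hq⟩

theorem simulation_symm (h : IsCover A' A e) : Simulation A A' fun p q => e q = p where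
  accept := by
    rintro _ q rfl hq
    exact h.accept.2 hq
  δ := by
    rintro _ q p a rfl hq
    exact h.δ_lift hq
  γ := by
    rintro _ q p l rfl hq
    obtain ⟨q', φ, hq', hφ, hγ⟩ := h.γ_lift hq
    induction φ using Quotient.inductionOn with | _ l₀
    have hperm : l.Perm (l₀.map e) := Multiset.coe_eq_coe.1 (by simpa using hφ.symm)
    obtain ⟨l', hl', hp⟩ := List.perm_comp_forall₂ (r := fun p q => e q = p) hperm
      (List.forall₂_map_left_iff.2 (List.forall₂_same.2 fun _ _ => rfl))
    refine ⟨l', q', hl', hq', ?_⟩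
    rw [Multiset.coe_eq_coe.2 hp]
    exact hγ

theorem language_eq (h : IsCover A' A e) (q : Q') : A'.language q = A.language (e q) :=
  (h.simulation.language_subset rfl).antisymm (h.simulation_symm.language_subset rfl)

theorem isLevel (h : IsCover A' A e) {ℓ : Q → ℕ} (hℓ : A.IsLevel ℓ) :
    A'.IsLevel fun q => ℓ (e q) where
  δ_le hq := hℓ.δ_le (h.δ hq)
  γ_le hq := hℓ.γ_le (h.γ hq)
  lt := by
    rintro q r φ hr ⟨q', hq⟩
    exact hℓ.lt (Multiset.mem_map_of_mem e hr) ⟨_, h.γ hq⟩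

theorem wellStructured (h : IsCover A' A e) (hA : A.WellStructured) : A'.WellStructured := by
  rintro q φ ⟨q', hq⟩
  obtain ⟨h₁, h₂⟩ := hA _ _ ⟨_, h.γ hq⟩
  refine ⟨by simpa using h₁, fun r hr => ?_⟩
  obtain ⟨h₃, h₄⟩ := h₂ _ (Multiset.mem_map_of_mem e hr)
  refine ⟨fun hacc => h₃ (h.accept.1 hacc), fun φ' => Set.eq_empty_iff_forall_notMem.2 ?_⟩
  rintro r' ⟨hr', hacc⟩
  exact Set.eq_empty_iff_forall_notMem.1 (h₄ (φ'.map e)) _ ⟨h.γ hr', h.accept.1 hacc⟩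

end IsCover

/-- The restriction of an automaton to a set of states. -/
def restrict (A : PomsetAutomaton α Q) (S : Set Q) : PomsetAutomaton α S where
  accept := {q | q.1 ∈ A.accept}
  δ q a := {q' | q'.1 ∈ A.δ q a}
  γ q φ := {q' | q'.1 ∈ A.γ q (φ.map Subtype.val)}
  finite_forks q := by
    refine Set.Finite.of_finite_image (f := Multiset.map Subtype.val)
      ((A.finite_forks q).subset ?_) (Multiset.map_injective Subtype.val_injective).injOn
    rintro _ ⟨φ, ⟨q', hq⟩, rfl⟩
    exact ⟨q', hq⟩

theorem isCover_restrict {A : PomsetAutomaton α Q} {S : Set Q}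
    (hδ : ∀ q ∈ S, ∀ a, A.δ q a ⊆ S)
    (hγ : ∀ q ∈ S, ∀ φ, A.γ q φ ⊆ S) (hφ : ∀ q ∈ S, ∀ φ, (A.γ q φ).Nonempty → ∀ r ∈ φ, r ∈ S) :
    IsCover (A.restrict S) A Subtype.val where
  accept := Iff.rfl
  δ := id
  γ := id
  δ_lift {q p a} h := ⟨⟨p, hδ q q.2 a h⟩, rfl, h⟩
  γ_lift {q p φ} h := by
    have hmap : (φ.pmap Subtype.mk (hφ q q.2 φ ⟨p, h⟩)).map Subtype.val = φ := by
      rw [Multiset.map_pmap, Multiset.pmap_eq_map, Multiset.map_id']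
    exact ⟨⟨p, hγ q q.2 φ h⟩, _, rfl, hmap, by simpa [restrict, hmap] using h⟩

theorem exists_card_le [Finite Q] (A : PomsetAutomaton α Q) :
    ∃ K, 0 < K ∧ ∀ q φ, (A.γ q φ).Nonempty → φ.card ≤ K := by
  obtain ⟨K, hK⟩ := ((Set.finite_iUnion A.finite_forks).image Multiset.card).bddAbove
  exact ⟨K + 1, by simp, fun q φ h =>
    (hK ⟨φ, Set.mem_iUnion.2 ⟨q, h⟩, rfl⟩).trans (Nat.le_succ K)⟩

theorem ForkAcyclic.exists_wellStructured [Finite Q] {A : PomsetAutomaton α Q}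
    (hA : A.ForkAcyclic) : ∃ (Q' : Type v) (A' : PomsetAutomaton α Q') (e : Q ↪ Q'),
      Finite Q' ∧ A'.ForkAcyclic ∧ A'.WellStructured ∧ A'.Implements A e := by
  obtain ⟨ℓ, hℓ, hℓ0, hℓd⟩ := hA.exists_isLevel
  obtain ⟨K, hK, hAK⟩ := A.exists_card_le
  set d := Nat.card Q
  let S : Set (ℕ × List Q) := {p | p.1 ≤ 2 ∧ p.2.length ≤ d}
  let M := StackMove A ℓ d (K ^ d)
  let B := stackAutomaton A M (K ^ d) fun h => h.width
  have hcl : A.MoveClosed d (K ^ d) M := StackMove.moveClosed hℓ (Nat.one_le_pow _ _ hK)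
  have hmode : ∀ m, nextMode m ≤ 2 := fun m => by unfold nextMode; split_ifs <;> simp
  have hcover : IsCover (B.restrict S) B Subtype.val := by
    refine isCover_restrict ?_ ?_ ?_
    · rintro p - a _ ⟨q, q', x, h, -, rfl⟩
      exact ⟨le_rfl, h.length_right⟩
    · rintro p - φ _ ⟨ψ, y, h, -, -, rfl⟩
      exact ⟨hmode _, h.length_right⟩
    · rintro p - φ ⟨_, ψ, y, h, -, rfl, -⟩ r hr
      obtain ⟨s, -, rfl⟩ : ∃ s ∈ ψ, (0, [s]) = r := by simpa using hr
      exact ⟨by simp, (hℓ0 s).trans_le (hℓd s)⟩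
  have hacyclic := (hcover.isLevel (stackAutomaton_isLevel (b := K ^ d) hℓ id)).forkAcyclic
  have hfin : S.Finite := ((Set.finite_Iic 2).prod (List.finite_length_le Q d)).subset
    fun p hp => hp
  refine ⟨S, B.restrict S, ⟨fun q => ⟨(2, [q]), le_rfl, (hℓ0 q).trans_le (hℓd q)⟩, fun q q' h => ?_⟩,
    hfin.to_subtype, hacyclic, hcover.wellStructured stackAutomaton_wellStructured,
    fun q => ?_, fun _ => hacyclic, fun _ => hfin.to_subtype⟩
  · simpa using h
  · rw [hcover.language_eq]
    exact (language_stackAutomaton hcl id hℓ hℓ0 hℓd hK le_rfl hAK q).symm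

end PomsetAutomaton

/-! ### Primitive recursive bounded closures -/

section PrimrecHelpers

open Primrec

variable {τ : Type u} {β : Type v} {σ : Type w} [Primcodable τ] [Primcodable β] [Primcodable σ]

theorem PrimrecRel.exists_mem {f : τ → List β} {p : τ → β → Prop} (hp : PrimrecRel p)
    (hf : Primrec f) : PrimrecPred fun a => ∃ b ∈ f a, p a b :=
  (PrimrecRel.exists_mem_list hp.swap).comp hf .id

theorem Primrec.filter_mem {f : τ → List β} {p : τ → β → Prop} [∀ a, DecidablePred (p a)]
    (hf : Primrec f) (hp : PrimrecRel p) : Primrec fun a => (f a).filter fun b => p a b := by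
  let : DecidableRel p := fun a b => inferInstance
  exact (PrimrecRel.listFilter (R := fun b a => p a b) hp.swap).comp hf .id

theorem PrimrecRel.mem : PrimrecRel fun (a : β) (l : List β) => a ∈ l :=
  (PrimrecRel.exists_mem (p := fun (x : β × List β) b => b = x.1)
    (Primrec.eq.comp snd (fst.comp fst)) snd).of_eq fun x => by simp

theorem Primrec.nat_pow : Primrec₂ fun a b : ℕ => a ^ b :=
  Primrec₂.unpaired'.1 Nat.Primrec.pow

end PrimrecHelpers

section BoundedClosure

variable {σ : Type u}

open scoped Classical in
/-- The elements of `univ` that `P` derives from `S`. -/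
noncomputable def deriveStep (univ : List σ) (P : List σ → σ → Prop) (S : List σ) : List σ :=
  univ.filter (P S)

/-- The elements of `univ` that are derivable by the rules in `P`. -/
noncomputable def derivable (univ : List σ) (P : List σ → σ → Prop) : List σ :=
  (deriveStep univ P)^[univ.length] []

variable {univ : List σ} {P : List σ → σ → Prop}

theorem mem_deriveStep {S : List σ} {t : σ} : t ∈ deriveStep univ P S ↔ t ∈ univ ∧ P S t := by
  simp [deriveStep]

theorem derivable_induction {C : σ → Prop}
    (h : ∀ S t, (∀ s ∈ S, C s) → t ∈ univ → P S t → C t) : ∀ t ∈ derivable univ P, C t := by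
  unfold derivable
  induction univ.length with
  | zero => simp
  | succ m ih =>
    intro t ht
    rw [Function.iterate_succ_apply', mem_deriveStep] at ht
    exact h _ t ih ht.1 ht.2

theorem mem_univ_of_mem_derivable {t : σ} (ht : t ∈ derivable univ P) : t ∈ univ :=
  derivable_induction (C := (· ∈ univ)) (fun _ _ _ h _ => h) t ht

theorem deriveStep_derivable (hP : ∀ S S' t, S ⊆ S' → P S t → P S' t) :
    deriveStep univ P (derivable univ P) = derivable univ P := by
  classical
  set F : ℕ → List σ := fun m => (deriveStep univ P)^[m] [] with hF
  have hsucc : ∀ m, F (m + 1) = deriveStep univ P (F m) := fun m =>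
    Function.iterate_succ_apply' _ _ _
  have hsub : ∀ m, (F m).Sublist (F (m + 1)) := by
    intro m
    induction m with
    | zero => exact List.nil_sublist _
    | succ m ih =>
      rw [hsucc (m + 1), hsucc m]
      refine List.monotone_filter_right _ fun t ht => ?_
      simp only [decide_eq_true_eq] at ht ⊢
      exact hP _ _ _ (by rw [← hsucc]; exact ih.subset) ht
  have hlen : ∀ m, (F m).length ≤ univ.length := by
    rintro (_ | m)
    · simp [hF]
    · rw [hsucc]
      exact List.length_filter_le _ _
  have hstab := Nat.stabilises_of_monotone (f := fun m => (F m).length) (b := univ.length)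
    (n := univ.length + 1) (monotone_nat_of_le_succ fun m => (hsub m).length_le) hlen
    (fun m hm => by rw [hsucc (m + 1), ← (hsub m).eq_of_length hm, ← hsucc]; exact hm) (Nat.le_succ _)
  have := (hsub univ.length).eq_of_length hstab.symm
  rw [hsucc] at this
  exact this.symm

theorem mem_derivable (hP : ∀ S S' t, S ⊆ S' → P S t → P S' t) {t : σ} (ht : t ∈ univ)
    (h : P (derivable univ P) t) : t ∈ derivable univ P := by
  rw [← deriveStep_derivable hP]
  exact mem_deriveStep.2 ⟨ht, h⟩

theorem Primrec.derivable {τ : Type v} [Primcodable τ] [Primcodable σ] {univ : τ → List σ}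
    {P : τ → List σ → σ → Prop} (hu : Primrec univ)
    (hP : PrimrecPred fun x : (τ × List σ) × σ => P x.1.1 x.1.2 x.2) :
    Primrec fun a => derivable (univ a) (P a) := by
  refine Primrec.nat_iterate (Primrec.list_length.comp hu) (Primrec.const []) (Primrec₂.mk ?_)
  classical
  exact Primrec.filter_mem (p := fun (x : τ × List σ) t => P x.1 x.2 t)
    (hu.comp Primrec.fst) hP

end BoundedClosure

namespace FinitePA

open PomsetAutomaton

variable {k : ℕ}

/-! ### The stack moves of a finite pomset automaton -/

/-- The lists of length at most `m` with entries below `n`. -/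
def boundedLists (n m : ℕ) : List (List ℕ) :=
  Nat.rec [[]] (fun _ L => [] :: (List.range n).flatMap fun a => L.map (a :: ·)) m

theorem mem_boundedLists {n m : ℕ} {l : List ℕ} :
    l ∈ boundedLists n m ↔ l.length ≤ m ∧ ∀ a ∈ l, a < n := by
  induction m generalizing l with
  | zero =>
    change l ∈ [[]] ↔ _
    simp +contextual [List.length_eq_zero_iff]
  | succ m ih =>
    change l ∈ [] :: (List.range n).flatMap (fun a => (boundedLists n m).map (a :: ·)) ↔ _
    cases l with
    | nil => simp
    | cons a l => simp [ih]; tauto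

/-- A bound on the sizes of the forks. -/
def forkBound (c : FinitePA k) : ℕ := (c.2.2.2.flatMap fun t => t.2.1).length + 1

/-- A bound on the sizes of the forks that result from flattening. -/
def width (c : FinitePA k) : ℕ := c.forkBound ^ c.size

/-- The candidates for moves `(x, ψ, y)` between stacks. -/
def triples (c : FinitePA k) : List (List ℕ × List ℕ × List ℕ) :=
  (boundedLists c.size c.size).flatMap fun x => (boundedLists c.size c.width).flatMap fun ψ =>
    (boundedLists c.size c.size).map fun y => (x, ψ, y)

theorem mem_triples {c : FinitePA k} {t : List ℕ × List ℕ × List ℕ} :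
    t ∈ c.triples ↔ t.1 ∈ boundedLists c.size c.size ∧ t.2.1 ∈ boundedLists c.size c.width ∧
      t.2.2 ∈ boundedLists c.size c.size := by
  obtain ⟨x, ψ, y⟩ := t
  simp [triples]

/-- The ways to replace every member of a list of fork targets along a completed move in `S`. -/
def flattenings (S : List (List ℕ × List ℕ × List ℕ)) (l : List ℕ) : List (List ℕ) :=
  l.foldr (fun r L => (S.filter fun s => s.1 = [r] ∧ s.2.2 = []).flatMap
    fun s => L.map (s.2.1 ++ ·)) [[]]

theorem mem_flattenings {S : List (List ℕ × List ℕ × List ℕ)} {l ψ : List ℕ} :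
    ψ ∈ flattenings S l ↔
      ∃ ψs, List.Forall₂ (fun r ψ => ([r], ψ, []) ∈ S) l ψs ∧ ψ = ψs.flatten := by
  induction l generalizing ψ with
  | nil => simp [flattenings]
  | cons r l ih =>
    change ψ ∈ ((S.filter fun s => s.1 = [r] ∧ s.2.2 = []).flatMap
      fun s => (flattenings S l).map (s.2.1 ++ ·)) ↔ _
    simp only [List.mem_flatMap, List.mem_filter, List.mem_map, decide_eq_true_eq]
    constructor
    · rintro ⟨⟨_, ψ₁, _⟩, ⟨hs, rfl, rfl⟩, ψ₂, hψ₂, rfl⟩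
      obtain ⟨ψs, hψs, rfl⟩ := ih.1 hψ₂
      exact ⟨ψ₁ :: ψs, .cons hs hψs, rfl⟩
    · rintro ⟨_, _ | ⟨hs, hψs⟩, rfl⟩
      exact ⟨_, ⟨hs, rfl, rfl⟩, _, ih.2 ⟨_, hψs, rfl⟩, rfl⟩

/-- The rules that generate the moves between stacks. -/
def MoveRule (c : FinitePA k) (S : List (List ℕ × List ℕ × List ℕ))
    (t : List ℕ × List ℕ × List ℕ) : Prop :=
  (t.1 = t.2.2 ∧ t.2.1 = []) ∨
  (∃ s ∈ S, ∃ s' ∈ S, t = (s.1, s.2.1 ++ s'.2.1, s'.2.2) ∧ s.2.2 = s'.1 ∧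
    (s.2.1 = [] ∨ s'.2.1 = [])) ∨
  (∃ s ∈ S, s.2.1.length = 1 ∧ t = (s.1, [], s.2.1 ++ s.2.2)) ∨
  (∃ f ∈ c.2.1, t = (f :: t.2.2, [], t.2.2)) ∨
  (t.2.1.length = 1 ∧ t.1 = t.2.1 ++ t.2.2) ∨
  (∃ g ∈ c.2.2.2, t.1 = g.1 :: t.1.tail ∧ t.2.2 = g.2.2 :: t.1.tail ∧
    t.2.1 ∈ flattenings S g.2.1)

theorem MoveRule.mono {c : FinitePA k} {S S' : List (List ℕ × List ℕ × List ℕ)}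
    {t : List ℕ × List ℕ × List ℕ} (hS : S ⊆ S') (h : MoveRule c S t) : MoveRule c S' t := by
  rcases h with h | ⟨s, hs, s', hs', h⟩ | ⟨s, hs, h⟩ | h | h | ⟨g, hg, h₁, h₂, h⟩
  · exact .inl h
  · exact .inr (.inl ⟨s, hS hs, s', hS hs', h⟩)
  · exact .inr (.inr (.inl ⟨s, hS hs, h⟩))
  · exact .inr (.inr (.inr (.inl h)))
  · exact .inr (.inr (.inr (.inr (.inl h))))
  · obtain ⟨ψs, hψs, h⟩ := mem_flattenings.1 h
    exact .inr (.inr (.inr (.inr (.inr ⟨g, hg, h₁, h₂,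
      mem_flattenings.2 ⟨ψs, hψs.imp fun _ _ h => hS h, h⟩⟩))))

/-- The moves between stacks. -/
noncomputable def moves (c : FinitePA k) : List (List ℕ × List ℕ × List ℕ) :=
  derivable c.triples c.MoveRule

section Primrec

open Primrec

theorem primrec_boundedLists : Primrec₂ boundedLists := by
  refine Primrec.nat_rec (f := fun _ : ℕ => [[]])
    (g := fun (n : ℕ) (p : ℕ × List (List ℕ)) =>
      [] :: (List.range n).flatMap fun a => p.2.map (a :: ·)) (.const _) (Primrec₂.mk ?_)
  refine list_cons.comp (.const []) (list_flatMap (list_range.comp fst) (Primrec₂.mk ?_))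
  exact list_map (snd.comp (snd.comp fst)) (Primrec₂.mk (list_cons.comp (snd.comp fst) snd))

theorem primrec_width : Primrec (width (k := k)) := by
  refine Primrec.nat_pow.comp (Primrec.succ.comp (list_length.comp
    (list_flatMap (snd.comp (snd.comp snd)) ?_))) fst
  exact Primrec₂.mk (fst.comp (snd.comp snd))

theorem primrec_triples : Primrec (triples (k := k)) := by
  have hn : Primrec (fun c : FinitePA k => boundedLists c.size c.size) :=
    primrec_boundedLists.comp fst fst
  refine list_flatMap hn (Primrec₂.mk (list_flatMap
    ((primrec_boundedLists.comp fst primrec_width).comp fst) (Primrec₂.mk (list_map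
    (hn.comp (fst.comp fst)) (Primrec₂.mk ?_)))))
  exact (snd.comp (fst.comp fst)).pair ((snd.comp fst).pair snd)

theorem primrec_flattenings : Primrec₂ flattenings := by
  refine Primrec₂.mk (list_foldr (f := fun x : List (List ℕ × List ℕ × List ℕ) × List ℕ => x.2)
    (g := fun _ => [[]]) (h := fun (x : List (List ℕ × List ℕ × List ℕ) × List ℕ) (p : ℕ × List (List ℕ)) =>
      (x.1.filter fun s => s.1 = [p.1] ∧ s.2.2 = []).flatMap
    fun s : List ℕ × List ℕ × List ℕ => p.2.map fun ψ : List ℕ => s.2.1 ++ ψ) snd (.const _) (Primrec₂.mk ?_))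
  refine list_flatMap (Primrec.filter_mem
    (p := fun (x : (List (List ℕ × List ℕ × List ℕ) × List ℕ) × ℕ × List (List ℕ)) s =>
      s.1 = [x.2.1] ∧ s.2.2 = []) (fst.comp fst) (PrimrecPred.and ?_ ?_)) (Primrec₂.mk ?_)
  · exact Primrec.eq.comp (fst.comp snd)
      (list_cons.comp (fst.comp (snd.comp fst)) (.const []))
  · exact Primrec.eq.comp (snd.comp (snd.comp snd)) (.const [])
  · exact list_map (snd.comp (snd.comp fst)) (Primrec₂.mk
      (list_append.comp (fst.comp (snd.comp (snd.comp fst))) snd))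

theorem primrecPred_moveRule : PrimrecPred fun x : (FinitePA k × List (List ℕ × List ℕ × List ℕ)) ×
    (List ℕ × List ℕ × List ℕ) => MoveRule x.1.1 x.1.2 x.2 := by
  refine .or ?_ (.or ?_ (.or ?_ (.or ?_ (.or ?_ ?_))))
  · exact .and (Primrec.eq.comp (fst.comp snd) (snd.comp (snd.comp snd)))
      (Primrec.eq.comp (fst.comp (snd.comp snd)) (.const []))
  · refine PrimrecRel.exists_mem (PrimrecRel.exists_mem (PrimrecPred.and ?_ (.and ?_ (.or ?_ ?_)))
      (snd.comp (fst.comp fst))) (snd.comp fst)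
    · exact Primrec.eq.comp (snd.comp (fst.comp fst)) ((fst.comp (snd.comp fst)).pair
        ((list_append.comp (fst.comp (snd.comp (snd.comp fst))) (fst.comp (snd.comp snd))).pair
          (snd.comp (snd.comp snd))))
    · exact Primrec.eq.comp (snd.comp (snd.comp (snd.comp fst))) (fst.comp snd)
    · exact Primrec.eq.comp (fst.comp (snd.comp (snd.comp fst))) (.const [])
    · exact Primrec.eq.comp (fst.comp (snd.comp snd)) (.const [])
  · refine PrimrecRel.exists_mem (PrimrecPred.and ?_ ?_) (snd.comp fst)
    · exact Primrec.eq.comp (list_length.comp (fst.comp (snd.comp snd))) (.const 1)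
    · exact Primrec.eq.comp (snd.comp fst) ((fst.comp snd).pair ((Primrec.const []).pair
        (list_append.comp (fst.comp (snd.comp snd)) (snd.comp (snd.comp snd)))))
  · refine PrimrecRel.exists_mem ?_ (fst.comp (snd.comp (fst.comp fst)))
    exact Primrec.eq.comp (snd.comp fst) ((list_cons.comp snd
      (snd.comp (snd.comp (snd.comp fst)))).pair ((Primrec.const []).pair
        (snd.comp (snd.comp (snd.comp fst)))))
  · exact .and (Primrec.eq.comp (list_length.comp (fst.comp (snd.comp snd))) (.const 1))
      (Primrec.eq.comp (fst.comp snd)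
        (list_append.comp (fst.comp (snd.comp snd)) (snd.comp (snd.comp snd))))
  · have htail : Primrec fun y : ((FinitePA k × List (List ℕ × List ℕ × List ℕ)) ×
        (List ℕ × List ℕ × List ℕ)) × ℕ × List ℕ × ℕ => y.1.2.1.tail :=
      list_tail.comp (fst.comp (snd.comp fst))
    refine PrimrecRel.exists_mem (PrimrecPred.and ?_ (.and ?_ ?_))
      (snd.comp (snd.comp (snd.comp (fst.comp fst))))
    · exact Primrec.eq.comp (fst.comp (snd.comp fst)) (list_cons.comp (fst.comp snd) htail)
    · exact Primrec.eq.comp (snd.comp (snd.comp (snd.comp fst)))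
        (list_cons.comp (snd.comp (snd.comp snd)) htail)
    · exact PrimrecRel.mem.comp (fst.comp (snd.comp (snd.comp fst)))
        (primrec_flattenings.comp (snd.comp (fst.comp fst)) (fst.comp (snd.comp snd)))

theorem primrec_moves : Primrec (moves (k := k)) :=
  Primrec.derivable primrec_triples primrecPred_moveRule

end Primrec

end FinitePA

theorem List.exists_map_val {n : ℕ} {l : List ℕ} (h : ∀ a ∈ l, a < n) :
    ∃ l' : List (Fin n), l = l'.map Fin.val :=
  ⟨l.pmap Fin.mk h, by simp [List.map_pmap]⟩

namespace FinitePA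

open PomsetAutomaton

variable {k : ℕ}

/-! ### Correctness of the moves of a finite pomset automaton -/

theorem exists_of_mem_boundedLists {n m : ℕ} {l : List ℕ} (h : l ∈ boundedLists n m) :
    ∃ l' : List (Fin n), l = l'.map Fin.val ∧ l'.length ≤ m := by
  rw [mem_boundedLists] at h
  obtain ⟨l', rfl⟩ := List.exists_map_val h.2
  exact ⟨l', rfl, by simpa using h.1⟩

theorem map_mem_boundedLists {n m : ℕ} {l : List (Fin n)} (h : l.length ≤ m) :
    l.map Fin.val ∈ boundedLists n m :=
  mem_boundedLists.2 ⟨by simpa using h, by simp⟩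

/-- A triple of lists of states, as a triple of lists of numbers. -/
def triple {n : ℕ} (x ψ y : List (Fin n)) : List ℕ × List ℕ × List ℕ :=
  (x.map Fin.val, ψ.map Fin.val, y.map Fin.val)

theorem map_val_inj {n : ℕ} {x y : List (Fin n)} : x.map Fin.val = y.map Fin.val ↔ x = y :=
  (List.map_injective_iff.2 Fin.val_injective).eq_iff

/-- The moves, as a relation between stacks of states. -/
def Move (c : FinitePA k) (x ψ y : List (Fin c.size)) : Prop := triple x ψ y ∈ c.moves

variable {c : FinitePA k}

theorem exists_of_mem_triples {t : List ℕ × List ℕ × List ℕ} (h : t ∈ c.triples) :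
    ∃ x ψ y : List (Fin c.size), t = triple x ψ y ∧ x.length ≤ c.size ∧ ψ.length ≤ c.width ∧
      y.length ≤ c.size := by
  obtain ⟨t₁, t₂, t₃⟩ := t
  obtain ⟨h₁, h₂, h₃⟩ := mem_triples.1 h
  obtain ⟨x, hx, hx'⟩ := exists_of_mem_boundedLists h₁
  obtain ⟨ψ, hψ, hψ'⟩ := exists_of_mem_boundedLists h₂
  obtain ⟨y, hy, hy'⟩ := exists_of_mem_boundedLists h₃
  exact ⟨x, ψ, y, by simp_all [triple], hx', hψ', hy'⟩

theorem triple_mem_triples {x ψ y : List (Fin c.size)} (hx : x.length ≤ c.size)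
    (hψ : ψ.length ≤ c.width) (hy : y.length ≤ c.size) : triple x ψ y ∈ c.triples :=
  mem_triples.2 ⟨map_mem_boundedLists hx, map_mem_boundedLists hψ, map_mem_boundedLists hy⟩

theorem mem_moves {t : List ℕ × List ℕ × List ℕ} (ht : t ∈ c.triples)
    (h : MoveRule c c.moves t) : t ∈ c.moves :=
  mem_derivable (P := c.MoveRule) (fun _ _ _ => MoveRule.mono) ht h

theorem Move.bounds {x ψ y : List (Fin c.size)} (h : c.Move x ψ y) :
    x.length ≤ c.size ∧ ψ.length ≤ c.width ∧ y.length ≤ c.size := by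
  have := mem_triples.1 (mem_univ_of_mem_derivable h)
  simp only [triple, mem_boundedLists, List.length_map] at this
  exact ⟨this.1.1, this.2.1.1, this.2.2.1⟩

theorem forkBound_pos : 0 < c.forkBound := Nat.succ_pos _

theorem width_pos : 1 ≤ c.width := Nat.one_le_pow _ _ forkBound_pos

theorem Move.comp {x ψ₁ y ψ₂ z : List (Fin c.size)} (h₁ : c.Move x ψ₁ y) (h₂ : c.Move y ψ₂ z)
    (h : ψ₁ = [] ∨ ψ₂ = []) : c.Move x (ψ₁ ++ ψ₂) z := by
  refine mem_moves (triple_mem_triples h₁.bounds.1 ?_ h₂.bounds.2.2)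
    (.inr (.inl ⟨_, h₁, _, h₂, ?_⟩))
  · rcases h with rfl | rfl
    · exact h₂.bounds.2.1
    · simpa using h₁.bounds.2.1
  · simpa [triple] using h

theorem moveClosed_move : c.toPA.MoveClosed c.size c.width c.Move where
  refl hx := mem_moves (triple_mem_triples hx (by simp) hx) (.inl ⟨rfl, rfl⟩)
  trans_left h₁ h₂ := h₁.comp h₂ (.inl rfl)
  trans_right h₁ h₂ := by simpa using h₁.comp h₂ (.inr rfl)
  call h hy := mem_moves (triple_mem_triples h.bounds.1 (by simp) hy)
    (.inr (.inr (.inl ⟨_, h, rfl, rfl⟩)))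
  ret {f y} hf hy := mem_moves (triple_mem_triples hy (by simp) (by omega))
    (.inr (.inr (.inr (.inl ⟨f, hf, rfl⟩))))
  atom hy := mem_moves (triple_mem_triples hy width_pos (by omega))
    (.inr (.inr (.inr (.inr (.inl ⟨rfl, rfl⟩)))))
  fork {q q' φ} h := by
    obtain ⟨l, hl, hφ⟩ := h
    obtain ⟨l', rfl⟩ : ∃ l' : List (Fin c.size), l = l'.map Fin.val := by
      refine List.exists_map_val fun a ha => ?_
      have ha : a ∈ (l : Multiset ℕ) := ha
      rw [← hφ] at ha
      obtain ⟨b, -, rfl⟩ := Multiset.mem_map.1 ha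
      exact b.2
    refine ⟨l', Multiset.map_injective Fin.val_injective (by simpa using hφ.symm),
      fun y ψs hy hψ hψs => mem_moves (triple_mem_triples hy hψ hy)
        (.inr (.inr (.inr (.inr (.inr ⟨_, hl, rfl, rfl, ?_⟩)))))⟩
    refine mem_flattenings.2 ⟨ψs.map (List.map Fin.val), ?_, by simp [triple, List.map_flatten]⟩
    rw [List.forall₂_map_left_iff, List.forall₂_map_right_iff]
    exact hψs

theorem Move.stackMove {ℓ : Fin c.size → ℕ} (hℓ : c.toPA.IsLevel ℓ) {x ψ y : List (Fin c.size)}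
    (h : c.Move x ψ y) : StackMove c.toPA ℓ c.size c.width x ψ y := by
  suffices ∀ t ∈ c.moves, ∃ x ψ y, t = triple x ψ y ∧
      StackMove c.toPA ℓ c.size c.width x ψ y by
    obtain ⟨x', ψ', y', heq, h⟩ := this _ h
    simp only [triple, Prod.mk.injEq, map_val_inj] at heq
    obtain ⟨rfl, rfl, rfl⟩ := heq
    exact h
  refine derivable_induction fun S t hS ht h => ?_
  obtain ⟨x, ψ, y, rfl, hx, hψ, hy⟩ := exists_of_mem_triples ht
  refine ⟨x, ψ, y, rfl, ?_⟩
  rcases h with ⟨h₁, h₂⟩ | ⟨s, hs, s', hs', heq, h₁, h₂⟩ | ⟨s, hs, h₁, heq⟩ | ⟨f, hf, heq⟩ |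
    ⟨h₁, h₂⟩ | ⟨g, hg, h₁, h₂, h₃⟩
  · simp only [triple, map_val_inj, List.map_eq_nil_iff] at h₁ h₂
    subst h₁ h₂
    exact .refl hx
  · obtain ⟨x₁, ψ₁, y₁, rfl, hm₁⟩ := hS _ hs
    obtain ⟨x₂, ψ₂, y₂, rfl, hm₂⟩ := hS _ hs'
    simp only [triple, Prod.mk.injEq, map_val_inj, ← List.map_append, List.map_eq_nil_iff]
      at heq h₁ h₂
    obtain ⟨rfl, rfl, rfl⟩ := heq
    subst h₁
    rcases h₂ with rfl | rfl
    · exact hm₁.trans_left hm₂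
    · simpa using hm₁.trans_right hm₂
  · obtain ⟨x₁, ψ₁, y₁, rfl, hm₁⟩ := hS _ hs
    simp only [triple, Prod.mk.injEq, map_val_inj, ← List.map_append, List.map_eq_nil_iff,
      List.length_map] at heq h₁
    obtain ⟨rfl, rfl, rfl⟩ := heq
    obtain ⟨r, rfl⟩ := List.length_eq_one_iff.1 h₁
    exact hm₁.call hy
  · simp only [triple, Prod.mk.injEq, List.map_eq_nil_iff, List.map_eq_cons_iff, and_true] at heq
    obtain ⟨⟨f, y', rfl, rfl, h⟩, rfl⟩ := heq
    rw [map_val_inj] at h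
    subst h
    exact .ret hf hx
  · simp only [triple, ← List.map_append, map_val_inj, List.length_map] at h₁ h₂
    obtain ⟨r, rfl⟩ := List.length_eq_one_iff.1 h₁
    subst h₂
    exact .atom width_pos hx
  · obtain ⟨q, l, q'⟩ := g
    obtain ⟨ψs, hψs, h₄⟩ := mem_flattenings.1 h₃
    dsimp only at hψs
    simp only [triple, List.map_eq_cons_iff] at h₁ h₂ h₄
    obtain ⟨q, x', rfl, rfl, -⟩ := h₁
    obtain ⟨q', y', rfl, rfl, h₂⟩ := h₂
    simp only [List.map_cons, List.tail_cons, map_val_inj] at h₂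
    subst h₂
    obtain ⟨l', ψs', rfl, rfl, hl⟩ : ∃ (l' : List (Fin c.size)) (ψs' : List (List (Fin c.size))),
        l = l'.map Fin.val ∧ ψs = ψs'.map (List.map Fin.val) ∧
          List.Forall₂ (fun r ψ => StackMove c.toPA ℓ c.size c.width [r] ψ []) l' ψs' := by
      clear hg h₃ h₄
      induction hψs with
      | nil => exact ⟨[], [], rfl, rfl, .nil⟩
      | cons h _ ih =>
        obtain ⟨l', ψs', rfl, rfl, hl⟩ := ih
        obtain ⟨x₁, ψ₁, y₁, heq, hm⟩ := hS _ h
        simp only [triple, Prod.mk.injEq, List.nil_eq, List.map_eq_nil_iff] at heq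
        obtain ⟨h₁, rfl, rfl⟩ := heq
        obtain ⟨r, rfl⟩ := List.length_eq_one_iff.1 (by simpa using (congrArg List.length h₁).symm)
        obtain rfl := by simpa using h₁
        exact ⟨r :: l', ψ₁ :: ψs', rfl, rfl, .cons hm hl⟩
    rw [← List.map_flatten, map_val_inj] at h₄
    subst h₄
    exact .fork hℓ ⟨_, hg, by simp⟩ hx hψ hl

theorem card_le_forkBound {q : Fin c.size} {φ : Multiset (Fin c.size)}
    (h : (c.toPA.γ q φ).Nonempty) : φ.card ≤ c.forkBound := by
  obtain ⟨q', l, hl, hφ⟩ := h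
  have hcard : φ.card = l.length := by simpa using congrArg Multiset.card hφ
  rw [hcard, forkBound, List.length_flatMap]
  exact (List.single_le_sum (by simp) _ (List.mem_map_of_mem (f := fun t => t.2.1.length) hl)).trans (Nat.le_succ _)

/-! ### The well-structured automaton as finite data -/

/-- The states of the stack automaton, where the states of `c` and the fork targets come first. -/
def stackStates (c : FinitePA k) : List (ℕ × List ℕ) :=
  (List.range c.size).map (fun q => (2, [q])) ++ ((List.range c.size).map (fun q => (0, [q])) ++
    (List.range 3).flatMap fun m => (boundedLists c.size c.size).map fun x => (m, x))

/-- The number of states of the stack automaton. -/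
def stackSize (c : FinitePA k) : ℕ := c.stackStates.length

/-- The mode and the stack with a given number. -/
def stackState (c : FinitePA k) (i : ℕ) : ℕ × List ℕ := c.stackStates.getD i (0, [])

open scoped Classical in
/-- The stack automaton as finite data. -/
noncomputable def wellStructured (c : FinitePA k) : FinitePA k :=
  (c.stackSize,
    (List.range c.stackSize).filter fun i =>
      (c.stackState i).1 = 2 ∧ ((c.stackState i).2, [], []) ∈ c.moves,
    c.2.2.1.flatMap fun t => (List.range c.stackSize).flatMap fun i =>
      ((List.range c.stackSize).filter fun j =>
        c.stackState j = (2, t.2.2 :: (c.stackState j).2.tail) ∧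
          ((c.stackState i).2, [], t.1 :: (c.stackState j).2.tail) ∈ c.moves).map
        fun j => (i, t.2.1, j),
    (c.moves.filter fun t => 2 ≤ t.2.1.length).flatMap fun t =>
      (List.range c.stackSize).flatMap fun i =>
        ((List.range c.stackSize).filter fun j =>
          (c.stackState i).2 = t.1 ∧ c.stackState j = (nextMode (c.stackState i).1, t.2.2)).map
          fun j => (i, t.2.1.map (c.size + ·), j))

section Primrec

open Primrec

theorem primrec_stackStates : Primrec (stackStates (k := k)) := by
  have hn : Primrec (fun c : FinitePA k => List.range c.size) := list_range.comp fst
  refine list_append.comp (list_map hn (Primrec₂.mk ?_)) (list_append.comp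
    (list_map hn (Primrec₂.mk ?_)) (list_flatMap (.const _) (Primrec₂.mk (list_map
    ((primrec_boundedLists.comp fst fst).comp fst) (Primrec₂.mk ?_)))))
  · exact (Primrec.const 2).pair (list_cons.comp snd (.const []))
  · exact (Primrec.const 0).pair (list_cons.comp snd (.const []))
  · exact (snd.comp fst).pair snd

theorem primrec_stackState : Primrec₂ (stackState (k := k)) :=
  (list_getD (0, [])).comp (primrec_stackStates.comp fst) snd

theorem primrec_nextMode : Primrec nextMode :=
  Primrec.ite (Primrec.eq.comp .id (.const 0)) (.const 1) (.const 2)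

theorem primrec_wellStructured : Primrec (wellStructured (k := k)) := by
  classical
  have hsize : Primrec (stackSize (k := k)) := list_length.comp primrec_stackStates
  have hrange : Primrec (fun c : FinitePA k => List.range c.stackSize) := list_range.comp hsize
  have hstack : Primrec₂ fun (c : FinitePA k) i => (c.stackState i).2 :=
    snd.comp primrec_stackState
  have hmap : Primrec fun x : ((FinitePA k × (List ℕ × List ℕ × List ℕ)) × ℕ) × ℕ =>
      x.1.1.2.2.1.map fun s => x.1.1.1.size + s :=
    list_map (fst.comp (snd.comp (snd.comp (fst.comp fst)))) (Primrec₂.mk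
      (Primrec.nat_add.comp (fst.comp (fst.comp (fst.comp (fst.comp fst)))) snd))
  refine hsize.pair (.pair ?_ (.pair ?_ ?_))
  · refine Primrec.filter_mem (p := fun (c : FinitePA k) i => (c.stackState i).1 = 2 ∧
      ((c.stackState i).2, [], []) ∈ c.moves) hrange (PrimrecPred.and ?_ ?_)
    · exact Primrec.eq.comp (fst.comp primrec_stackState) (.const 2)
    · exact PrimrecRel.mem.comp (Primrec.pair hstack (.const _)) (primrec_moves.comp fst)
  · refine list_flatMap (fst.comp (snd.comp snd)) (Primrec₂.mk (list_flatMap (hrange.comp fst)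
      (Primrec₂.mk (list_map (Primrec.filter_mem
        (p := fun (x : (FinitePA k × (ℕ × Fin k × ℕ)) × ℕ) (j : ℕ) =>
          x.1.1.stackState j = (2, x.1.2.2.2 :: (x.1.1.stackState j).2.tail) ∧
          ((x.1.1.stackState x.2).2, [], x.1.2.1 :: (x.1.1.stackState j).2.tail) ∈ x.1.1.moves)
        (hrange.comp (fst.comp fst)) (PrimrecPred.and ?_ ?_)) (Primrec₂.mk ?_)))))
    · exact Primrec.eq.comp (primrec_stackState.comp (fst.comp (fst.comp fst)) snd)
        ((Primrec.const 2).pair (list_cons.comp (snd.comp (snd.comp (snd.comp (fst.comp fst))))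
          (list_tail.comp (hstack.comp (fst.comp (fst.comp fst)) snd))))
    · exact PrimrecRel.mem.comp (Primrec.pair (hstack.comp (fst.comp (fst.comp fst)) (snd.comp fst))
        ((Primrec.const []).pair (list_cons.comp (fst.comp (snd.comp (fst.comp fst)))
          (list_tail.comp (hstack.comp (fst.comp (fst.comp fst)) snd)))))
        (primrec_moves.comp (fst.comp (fst.comp fst)))
    · exact (snd.comp fst).pair ((fst.comp (snd.comp (snd.comp (fst.comp fst)))).pair snd)
  · refine list_flatMap (Primrec.filter_mem
      (p := fun (_ : FinitePA k) (t : List ℕ × List ℕ × List ℕ) => 2 ≤ t.2.1.length)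
      primrec_moves (Primrec.nat_le.comp (.const 2) (list_length.comp (fst.comp (snd.comp snd)))))
      (Primrec₂.mk (list_flatMap (hrange.comp fst)
      (Primrec₂.mk (list_map (Primrec.filter_mem
        (p := fun (x : (FinitePA k × (List ℕ × List ℕ × List ℕ)) × ℕ) (j : ℕ) =>
          (x.1.1.stackState x.2).2 = x.1.2.1 ∧
          x.1.1.stackState j = (nextMode (x.1.1.stackState x.2).1, x.1.2.2.2))
        (hrange.comp (fst.comp fst)) (PrimrecPred.and ?_ ?_)) (Primrec₂.mk ?_)))))
    · exact Primrec.eq.comp (hstack.comp (fst.comp (fst.comp fst)) (snd.comp fst))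
        (fst.comp (snd.comp (fst.comp fst)))
    · exact Primrec.eq.comp (primrec_stackState.comp (fst.comp (fst.comp fst)) snd)
        (Primrec.pair (primrec_nextMode.comp (fst.comp (primrec_stackState.comp
          (fst.comp (fst.comp fst)) (snd.comp fst)))) (snd.comp (snd.comp (snd.comp (fst.comp fst)))))
    · exact (snd.comp fst).pair (hmap.pair snd)

end Primrec

theorem stackState_of_lt {q : ℕ} (hq : q < c.size) : c.stackState q = (2, [q]) := by
  simp [stackState, stackStates, List.getElem?_append, hq]

theorem stackState_size_add {q : ℕ} (hq : q < c.size) : c.stackState (c.size + q) = (0, [q]) := by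
  simp [stackState, stackStates, List.getElem?_append, hq]

theorem two_mul_size_le : 2 * c.size ≤ c.stackSize := by
  simp only [stackSize, stackStates, List.length_append, List.length_map, List.length_range]
  omega

theorem exists_stackState {m : ℕ} {x : List (Fin c.size)} (hm : m ≤ 2) (hx : x.length ≤ c.size) :
    ∃ i < c.stackSize, c.stackState i = (m, x.map Fin.val) := by
  have : (m, x.map Fin.val) ∈ c.stackStates := by
    have := map_mem_boundedLists hx
    simp only [stackStates, List.mem_append, List.mem_flatMap, List.mem_range, List.mem_map]
    exact .inr (.inr ⟨m, by omega, _, this, rfl⟩)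
  obtain ⟨i, hi, h⟩ := List.mem_iff_getElem.1 this
  exact ⟨i, hi, by simp [stackState, List.getD_eq_getElem?_getD, hi, h]⟩

theorem exists_stackState_eq {i : ℕ} (hi : i < c.stackSize) :
    ∃ p : ℕ × List (Fin c.size), c.stackState i = (p.1, p.2.map Fin.val) := by
  have : c.stackState i ∈ c.stackStates := by
    rw [stackState, List.getD_eq_getElem _ _ hi]
    exact List.getElem_mem hi
  simp only [stackStates, List.mem_append, List.mem_flatMap, List.mem_range, List.mem_map] at this
  rcases this with ⟨q, hq, h⟩ | ⟨q, hq, h⟩ | ⟨m, -, x, hx, h⟩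
  · exact ⟨(2, [⟨q, hq⟩]), h.symm⟩
  · exact ⟨(0, [⟨q, hq⟩]), h.symm⟩
  · obtain ⟨x, rfl, -⟩ := exists_of_mem_boundedLists hx
    exact ⟨(m, x), h.symm⟩

theorem nextMode_le (m : ℕ) : nextMode m ≤ 2 := by
  unfold nextMode
  split_ifs <;> simp

theorem mem_accept_wellStructured {i : Fin c.wellStructured.size} :
    i ∈ c.wellStructured.toPA.accept ↔
      (c.stackState i).1 = 2 ∧ ((c.stackState i).2, [], []) ∈ c.moves := by
  have hi : (i : ℕ) < c.stackSize := i.2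
  change (i : ℕ) ∈ c.wellStructured.2.1 ↔ _
  simp [wellStructured, hi]

theorem mem_δ_wellStructured {i j : Fin c.wellStructured.size} {a : Fin k} :
    j ∈ c.wellStructured.toPA.δ i a ↔ ∃ q q', (q, a, q') ∈ c.2.2.1 ∧
      c.stackState j = (2, q' :: (c.stackState j).2.tail) ∧
        ((c.stackState i).2, [], q :: (c.stackState j).2.tail) ∈ c.moves := by
  have hi : (i : ℕ) < c.stackSize := i.2
  have hj : (j : ℕ) < c.stackSize := j.2
  change ((i : ℕ), a, (j : ℕ)) ∈ c.wellStructured.2.2.1 ↔ _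
  simp only [wellStructured, List.mem_flatMap, List.mem_map,
    List.mem_filter, List.mem_range, decide_eq_true_eq, Prod.mk.injEq]
  constructor
  · rintro ⟨⟨q, a, q'⟩, hq, i, -, j, ⟨-, h⟩, rfl, rfl, rfl⟩
    exact ⟨q, q', hq, h⟩
  · rintro ⟨q, q', hq, h⟩
    exact ⟨(q, a, q'), hq, i, hi, j, ⟨hj, h⟩, rfl, rfl, rfl⟩

theorem mem_γ_wellStructured {i j : Fin c.wellStructured.size}
    {φ : Multiset (Fin c.wellStructured.size)} :
    j ∈ c.wellStructured.toPA.γ i φ ↔ ∃ x ψ y, (x, ψ, y) ∈ c.moves ∧ 2 ≤ ψ.length ∧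
      (c.stackState i).2 = x ∧ c.stackState j = (nextMode (c.stackState i).1, y) ∧
        φ.map Fin.val = (ψ.map (c.size + ·) : List ℕ) := by
  have hi : (i : ℕ) < c.stackSize := i.2
  have hj : (j : ℕ) < c.stackSize := j.2
  change (∃ l : List ℕ, ((i : ℕ), l, (j : ℕ)) ∈ c.wellStructured.2.2.2 ∧
    φ.map Fin.val = (l : Multiset ℕ)) ↔ _
  simp only [wellStructured, List.mem_flatMap, List.mem_map,
    List.mem_filter, List.mem_range, decide_eq_true_eq, Prod.mk.injEq]
  constructor
  · rintro ⟨_, ⟨⟨x, ψ, y⟩, ⟨ht, hψ⟩, i, -, j, ⟨-, h₁, h₂⟩, rfl, rfl, rfl⟩, hφ⟩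
    exact ⟨x, ψ, y, ht, hψ, h₁, h₂, hφ⟩
  · rintro ⟨x, ψ, y, ht, hψ, h₁, h₂, hφ⟩
    exact ⟨_, ⟨(x, ψ, y), ⟨ht, hψ⟩, i, hi, j, ⟨hj, h₁, h₂⟩, rfl, rfl, rfl⟩, hφ⟩

theorem exists_isCover_wellStructured (c : FinitePA k) :
    ∃ e : Fin c.wellStructured.size → ℕ × List (Fin c.size),
      (∀ i : Fin c.wellStructured.size, c.stackState i = ((e i).1, (e i).2.map Fin.val)) ∧
      IsCover c.wellStructured.toPA
        (stackAutomaton c.toPA c.Move c.width fun h => h.bounds.2.1) e := by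
  choose e he using fun i : Fin c.wellStructured.size => exists_stackState_eq (c := c) i.2
  have hinj : ∀ {i : Fin c.wellStructured.size} {m} {x : List (Fin c.size)},
      c.stackState i = (m, x.map Fin.val) ↔ e i = (m, x) := by
    intro i m x
    rw [he, Prod.mk.injEq, map_val_inj, Prod.ext_iff]
  let target : Fin c.size → Fin c.wellStructured.size := fun q => ⟨c.size + q, by
    have := q.2
    exact lt_of_lt_of_le (by omega) (two_mul_size_le (c := c))⟩
  have htarget : ∀ q, e (target q) = (0, [q]) := fun q => hinj.1 (stackState_size_add q.2)
  refine ⟨e, he, ?_, ?_, ?_, ?_, ?_⟩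
  · intro i
    rw [mem_accept_wellStructured, he i]
    exact Iff.rfl
  · intro i j a hj
    obtain ⟨q, q', hq, h₁, h₂⟩ := mem_δ_wellStructured.1 hj
    obtain ⟨x, ψ, y, heq, -⟩ := exists_of_mem_triples (mem_univ_of_mem_derivable h₂)
    simp only [triple, Prod.mk.injEq, List.nil_eq, List.map_eq_nil_iff] at heq
    obtain ⟨hx, rfl, hy⟩ := heq
    obtain ⟨q, y, rfl, rfl, htail⟩ := List.map_eq_cons_iff.1 hy.symm
    rw [he j, Prod.mk.injEq] at h₁
    obtain ⟨q', z, hz, rfl, hz'⟩ := List.map_eq_cons_iff.1 h₁.2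
    rw [he j, hz] at htail
    rw [he i] at hx
    refine ⟨q, q', y, ?_, hq, Prod.ext h₁.1 ?_⟩
    · rw [he i, hy] at h₂
      exact h₂
    · rw [hz, map_val_inj.1 htail]
  · intro i j φ hj
    obtain ⟨_, ψ, _, h, hψ, rfl, hj, hφ⟩ := mem_γ_wellStructured.1 hj
    obtain ⟨x, ψ, y, heq, -⟩ := exists_of_mem_triples (mem_univ_of_mem_derivable h)
    simp only [triple, Prod.mk.injEq] at heq
    obtain ⟨hx, rfl, rfl⟩ := heq
    rw [he i] at h hj
    refine ⟨ψ, y, h, by simpa using hψ, ?_, hinj.1 hj⟩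
    have hφ' : φ = (ψ.map target : List _) :=
      Multiset.map_injective Fin.val_injective (by simpa [target, Function.comp_def] using hφ)
    simp [hφ', Function.comp_def, htarget]
  · rintro i _ a ⟨q, q', x, h, hq, rfl⟩
    obtain ⟨j, hj, hj'⟩ := exists_stackState (m := 2) (x := q' :: x) le_rfl h.bounds.2.2
    refine ⟨⟨j, hj⟩, hinj.1 hj', mem_δ_wellStructured.2 ⟨q, q', hq, ?_, ?_⟩⟩
    · simp [hj']
    · rw [he i, hj']
      exact h
  · rintro i _ _ ⟨ψ, y, h, hψ, rfl, rfl⟩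
    obtain ⟨j, hj, hj'⟩ := exists_stackState (nextMode_le (e i).1) h.bounds.2.2
    refine ⟨⟨j, hj⟩, (ψ.map target : List _), hinj.1 hj', ?_, mem_γ_wellStructured.2
      ⟨_, _, _, h, by simpa using hψ, ?_, ?_, ?_⟩⟩
    · simp [Function.comp_def, htarget]
    · rw [he i]
    · rw [he i]
      exact hj'
    · simp [target, Function.comp_def]

theorem wellStructured_spec (hc : c.toPA.ForkAcyclic) :
    ∃ h : c.size ≤ c.wellStructured.size,
      c.wellStructured.toPA.ForkAcyclic ∧ c.wellStructured.toPA.WellStructured ∧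
        c.wellStructured.toPA.Implements c.toPA (Fin.castLEEmb h) := by
  obtain ⟨ℓ, hℓ, hℓ0, hℓd⟩ := hc.exists_isLevel
  simp only [Nat.card_eq_fintype_card, Fintype.card_fin] at hℓd
  obtain ⟨e, he, hcover⟩ := c.exists_isCover_wellStructured
  have hacyclic := (hcover.isLevel (stackAutomaton_isLevel hℓ (Move.stackMove hℓ))).forkAcyclic
  have hsize : c.size ≤ c.wellStructured.size := by
    have := c.two_mul_size_le
    change c.size ≤ c.stackSize
    omega
  refine ⟨hsize, hacyclic, hcover.wellStructured stackAutomaton_wellStructured, fun q => ?_,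
    fun _ => hacyclic, fun _ => inferInstance⟩
  have heq : e (Fin.castLEEmb hsize q) = (2, [q]) := by
    have := he (Fin.castLEEmb hsize q)
    rw [show ((Fin.castLEEmb hsize q : Fin _) : ℕ) = q from rfl, stackState_of_lt q.2] at this
    rw [Prod.mk.injEq] at this
    exact Prod.ext this.1.symm (map_val_inj.1 this.2.symm)
  rw [hcover.language_eq, heq]
  exact (language_stackAutomaton moveClosed_move (Move.stackMove hℓ) hℓ hℓ0 hℓd forkBound_pos
    le_rfl (fun _ _ => card_le_forkBound) q).symm

end FinitePA

theorem mainTheorem4 :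
    (∀ (α : Type u) [Finite α] (Q : Type v) [Finite Q] (A : PomsetAutomaton α Q),
      A.ForkAcyclic →
        ∃ (Q' : Type v) (A' : PomsetAutomaton α Q') (e : Q ↪ Q'),
          Finite Q' ∧ A'.ForkAcyclic ∧ A'.WellStructured ∧ A'.Implements A e) ∧
    (∀ k : ℕ, ∃ f : FinitePA k → FinitePA k, Computable f ∧
      ∀ c : FinitePA k, c.toPA.ForkAcyclic →
        ∃ h : c.size ≤ (f c).size,
          (f c).toPA.ForkAcyclic ∧ (f c).toPA.WellStructured ∧
            (f c).toPA.Implements c.toPA (Fin.castLEEmb h)) :=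
  ⟨fun _ _ _ _ _ hA => hA.exists_wellStructured,
    fun _ => ⟨FinitePA.wellStructured, FinitePA.primrec_wellStructured.to_comp,
      fun _ hc => FinitePA.wellStructured_spec hc⟩⟩
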